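/- Let $C$ be a field of characteristic $p>0$ and let $A$ be a (not necessarily commutative) group scheme over $C$, with group law $\oplus$ and $x\ominus y:=x\oplus y^{-1}$, such that $A$ and $A\times_C A$ are integral, so that the function fields $K_A$ and $K_{A\times A}$ exist (for example an abelian variety, or any smooth connected group scheme of finite type over $C$). A higher derivation on a ring $S$ is a ring homomorphism $\theta:S\to S[[T]]$, $\theta(s)=\sum_i\theta^{(i)}(s)T^i$, with $\theta^{(0)}(s)=s$. It is iterative if $\theta^{(i)}\circ\theta^{(j)}=\binom{i+j}{i}\theta^{(i+j)}$ for all $i,j\ge 0$. A ring homomorphism $f:S\to S'$ between rings with iterative derivations $\theta,\theta'$ is an ID-homomorphism if $\theta'\circ f=f[[T]]\circ\theta$, where $f[[T]]$ is $f$ applied to the coefficients. Let $\theta$ be a higher derivation on $L:=K_A(t)$ extending the iterative derivation $t\mapsto t+T$, with constants $C$, on $C(t)$; it is automatically $C$-linear. Let $D:=K_A$ with the trivial higher derivation $d\mapsto d$, and extend $\theta$ to $LD:=\operatorname{Quot}(L\otimes_C D)$ by $\theta^{(k)}(l\otimes d)=\theta^{(k)}(l)\otimes d$ and $\theta(r/s)=\theta(r)\theta(s)^{-1}$.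 Let $\eta_L\in A(L)$ and $\eta_D\in A(D)$ be given by the generic point of $A$. Then there is a unique homomorphism of $C$-algebras $\rho:LD\to LD$ which is the identity on $D$ and on $t$ and is induced by addition, i.e. $\rho_*(\eta_L)=\eta_L\oplus\eta_D$ in $A(LD)$; it is an automorphism. Moreover, let $R\subseteq C(t)[[T,U]]$ be the subring of all power series $P(t,T,U)$ with $P(t+U,T,0)=P(t,T,U)$, and let $\theta_U:L\to L[[U]]$ and $\theta_{T+U}:L\to L[[T,U]]$ be $\theta$ with $T$ replaced by $U$ and by $T+U$. Then the following are equivalent: 1. $\theta$ is iterative and $\rho:LD\to LD$ is an ID-homomorphism; 2. the point $\theta_{U,*}(\eta_L)\ominus\theta_{T+U,*}(\eta_L)$ of $A(L[[T,U]])$ lies in (the image of) $A(R)$. -/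

import Mathlib

open CategoryTheory AlgebraicGeometry MonoidalCategory MonObj
open scoped TensorProduct PowerSeries

noncomputable section

namespace IDGroup

universe u

/-! ### Higher and iterative derivations -/

section HigherDerivations

/-- A (`C`-linear) higher derivation on a `C`-algebra `R`: a homomorphism `θ : R → R⟦T⟧` of
`C`-algebras such that `θ(r)|_{T = 0} = r`.  For `C = ℤ` this is the general notion; a higher
derivation on a field extending the derivation by `t` on `C(t)` is automatically `C`-linear. -/
structure HigherDerivation (C R : Type*) [CommRing C] [CommRing R] [Algebra C R] where
  toAlgHom : R →ₐ[C] R⟦X⟧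
  constantCoeff_toAlgHom : ∀ r, PowerSeries.constantCoeff (toAlgHom r) = r

variable {C : Type*} [CommRing C] {R S : Type*} [CommRing R] [Algebra C R] [CommRing S]
  [Algebra C S]

/-- `θ` is iterative if `θ⁽ⁱ⁾ ∘ θ⁽ʲ⁾ = (i + j choose i) θ⁽ⁱ⁺ʲ⁾` for all `i, j`, where `θ⁽ⁿ⁾(r)` is
the coefficient of `Tⁿ` in `θ(r)`. -/
def HigherDerivation.IsIterative (θ : HigherDerivation C R) : Prop :=
  ∀ (i j : ℕ) (r : R),
    PowerSeries.coeff i (θ.toAlgHom (PowerSeries.coeff j (θ.toAlgHom r))) =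
      (i + j).choose i • PowerSeries.coeff (i + j) (θ.toAlgHom r)

/-- `f` is an HD-homomorphism: `θ' ∘ f = f⟦T⟧ ∘ θ`. -/
def IsHDHom (θ : HigherDerivation C R) (θ' : HigherDerivation C S) (f : R →ₐ[C] S) : Prop :=
  θ'.toAlgHom.comp f = (PowerSeries.mapAlgHom f).comp θ.toAlgHom

/-- An ID-homomorphism is an HD-homomorphism between ID-rings. -/
def IsIDHom (θ : HigherDerivation C R) (θ' : HigherDerivation C S) (f : R →ₐ[C] S) : Prop :=
  θ.IsIterative ∧ θ'.IsIterative ∧ IsHDHom θ θ' f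

variable (C R) in
/-- Evaluation of a power series at `0`. -/
def evalZero : R⟦X⟧ →ₐ[C] R where
  __ := PowerSeries.constantCoeff (R := R)
  commutes' c := by
    change PowerSeries.constantCoeff (algebraMap C R⟦X⟧ c) = _
    rw [PowerSeries.algebraMap_apply, PowerSeries.constantCoeff_C]

variable (C R) in
/-- The inclusion of `R` in `R⟦X⟧` as the constant power series. -/
def constSeries : R →ₐ[C] R⟦X⟧ := IsScalarTower.toAlgHom C R R⟦X⟧

lemma constSeries_apply (r : R) : constSeries C R r = PowerSeries.C r := rfl

variable (C R) in
/-- The trivial higher derivation `r ↦ r · T⁰`. -/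
def HigherDerivation.trivial : HigherDerivation C R where
  toAlgHom := constSeries C R
  constantCoeff_toAlgHom r := PowerSeries.constantCoeff_C r

lemma constantCoeff_map_eq (f : R →+* S) (x : R⟦X⟧) :
    PowerSeries.constantCoeff (PowerSeries.map f x) = f (PowerSeries.constantCoeff x) := by
  rw [← PowerSeries.coeff_zero_eq_constantCoeff_apply, PowerSeries.coeff_map,
    PowerSeries.coeff_zero_eq_constantCoeff_apply]

/-- The higher derivation on the tensor product:
`θ⁽ᵏ⁾(r ⊗ s) = ∑_{i + j = k} θ⁽ⁱ⁾(r) ⊗ θ⁽ʲ⁾(s)`. -/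
def HigherDerivation.tensor (θ : HigherDerivation C R) (θ' : HigherDerivation C S) :
    HigherDerivation C (R ⊗[C] S) where
  toAlgHom := Algebra.TensorProduct.lift
    ((PowerSeries.mapAlgHom (Algebra.TensorProduct.includeLeft : R →ₐ[C] R ⊗[C] S)).comp
      θ.toAlgHom)
    ((PowerSeries.mapAlgHom (Algebra.TensorProduct.includeRight : S →ₐ[C] R ⊗[C] S)).comp
      θ'.toAlgHom)
    (fun _ _ => Commute.all _ _)
  constantCoeff_toAlgHom x := by
    induction x with
    | zero => simp
    | add x y hx hy => simp only [map_add, hx, hy]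
    | tmul r s =>
      simp [PowerSeries.mapAlgHom_apply, constantCoeff_map_eq, θ.constantCoeff_toAlgHom,
        θ'.constantCoeff_toAlgHom]

lemma HigherDerivation.isUnit_map (θ : HigherDerivation C R) (M : Submonoid R) (S : Type*)
    [CommRing S] [Algebra C S] [Algebra R S] [IsScalarTower C R S] [IsLocalization M S] (y : M) :
    IsUnit (((PowerSeries.mapAlgHom (IsScalarTower.toAlgHom C R S)).comp θ.toAlgHom) y) := by
  rw [PowerSeries.isUnit_iff_constantCoeff]
  simp only [AlgHom.comp_apply, PowerSeries.mapAlgHom_apply]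
  rw [constantCoeff_map_eq, θ.constantCoeff_toAlgHom]
  exact IsLocalization.map_units S y

/-- The higher derivation on a localisation: `θ(r/s) = θ(r) θ(s)⁻¹`. -/
def HigherDerivation.localization (θ : HigherDerivation C R) (M : Submonoid R) (S : Type*)
    [CommRing S] [Algebra C S] [Algebra R S] [IsScalarTower C R S] [IsLocalization M S] :
    HigherDerivation C S where
  toAlgHom := IsLocalization.liftAlgHom (M := M)
    (f := (PowerSeries.mapAlgHom (IsScalarTower.toAlgHom C R S)).comp θ.toAlgHom)
    (θ.isUnit_map M S)
  constantCoeff_toAlgHom x := by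
    have h : ((PowerSeries.constantCoeff (R := S)).comp
        (IsLocalization.lift (M := M) (θ.isUnit_map M S) : S →+* S⟦X⟧)) = RingHom.id S := by
      apply IsLocalization.ringHom_ext M
      ext r
      simp only [RingHom.comp_apply, IsLocalization.lift_eq, RingHom.id_apply]
      change PowerSeries.constantCoeff
        (((PowerSeries.mapAlgHom (IsScalarTower.toAlgHom C R S)).comp θ.toAlgHom) r) = _
      rw [AlgHom.comp_apply, PowerSeries.mapAlgHom_apply,
        constantCoeff_map_eq, θ.constantCoeff_toAlgHom]
      rfl
    exact congrArg (fun f : S →+* S => f x) h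

end HigherDerivations

/-! ### Power series in two variables

`R⟦T, U⟧` is modelled as `R⟦U⟧⟦T⟧`: the coefficient of `Tⁱ Uʲ` in `P : R⟦X⟧⟦X⟧` is
`coeff j (coeff i P)`. -/

section TwoVariables

variable {C : Type*} [CommRing C] {R : Type*} [CommRing R] [Algebra C R]

/-- The power series `f(T + U)`, that is `∑ (i + j choose i) fᵢ₊ⱼ Tⁱ Uʲ`. -/
def addSubstFun (f : R⟦X⟧) : R⟦X⟧⟦X⟧ :=
  PowerSeries.mk fun i => PowerSeries.mk fun j =>
    ((i + j).choose i : R) * PowerSeries.coeff (i + j) f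

lemma coeff_addSubstFun (f : R⟦X⟧) (i j : ℕ) :
    PowerSeries.coeff j (PowerSeries.coeff i (addSubstFun f)) =
      ((i + j).choose i : R) * PowerSeries.coeff (i + j) f := by
  simp [addSubstFun]

lemma addSubstFun_C (r : R) : addSubstFun (PowerSeries.C r) = PowerSeries.C (PowerSeries.C r) := by
  ext i j
  rw [coeff_addSubstFun, PowerSeries.coeff_C, PowerSeries.coeff_C]
  rcases i with _ | i
  · rcases j with _ | j <;> simp [PowerSeries.coeff_C]
  · simp

lemma addSubstFun_add (f g : R⟦X⟧) : addSubstFun (f + g) = addSubstFun f + addSubstFun g := by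
  ext i j
  simp only [coeff_addSubstFun, map_add, mul_add]

lemma addSubstFun_mul (f g : R⟦X⟧) : addSubstFun (f * g) = addSubstFun f * addSubstFun g := by
  ext i j
  have key := congrArg (fun q : Polynomial R => q.coeff j)
    (Polynomial.hasseDeriv_mul i (PowerSeries.trunc (i + j + 1) f)
      (PowerSeries.trunc (i + j + 1) g))
  simp only [Polynomial.finsetSum_coeff, Polynomial.coeff_mul, Polynomial.hasseDeriv_coeff]
    at key
  rw [coeff_addSubstFun, PowerSeries.coeff_mul, PowerSeries.coeff_mul]
  rw [map_sum]
  simp only [PowerSeries.coeff_mul, coeff_addSubstFun]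
  rw [add_comm j i] at key
  convert key using 1
  · congr 1
    refine Finset.sum_congr rfl fun ab hab => ?_
    rw [Finset.HasAntidiagonal.mem_antidiagonal] at hab
    rw [PowerSeries.coeff_trunc, PowerSeries.coeff_trunc, if_pos (by omega), if_pos (by omega)]
  · refine Finset.sum_congr rfl fun ab hab => Finset.sum_congr rfl fun cd hcd => ?_
    rw [Finset.HasAntidiagonal.mem_antidiagonal] at hab hcd
    rw [PowerSeries.coeff_trunc, PowerSeries.coeff_trunc, if_pos (by omega), if_pos (by omega),
      add_comm cd.1, add_comm cd.2]

variable (C R) in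
/-- The substitution `T ↦ T + U`, as a homomorphism `R⟦T⟧ → R⟦T, U⟧`. -/
def addSubst : R⟦X⟧ →ₐ[C] R⟦X⟧⟦X⟧ where
  toFun := addSubstFun
  map_one' := by simpa using addSubstFun_C (1 : R)
  map_mul' := addSubstFun_mul
  map_zero' := by simpa using addSubstFun_C (0 : R)
  map_add' := addSubstFun_add
  commutes' c := by
    rw [PowerSeries.algebraMap_apply, addSubstFun_C, PowerSeries.algebraMap_apply,
      PowerSeries.algebraMap_apply]

/-- `θ_U : R → R⟦U⟧ ⊆ R⟦T, U⟧`. -/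
def HigherDerivation.inU (θ : HigherDerivation C R) : R →ₐ[C] R⟦X⟧⟦X⟧ :=
  (constSeries C R⟦X⟧).comp θ.toAlgHom

/-- `θ_{T+U} : R → R⟦T, U⟧`. -/
def HigherDerivation.inTU (θ : HigherDerivation C R) : R →ₐ[C] R⟦X⟧⟦X⟧ :=
  (addSubst C R).comp θ.toAlgHom

end TwoVariables

/-! ### The rational function field -/

section RationalFunctions

variable (C : Type*) [Field C]

/-- The iterative derivation with respect to `t` on `C[t]`, given by `t ↦ t + T`. -/
def polyDerivation : HigherDerivation C (Polynomial C) where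
  toAlgHom := Polynomial.aeval (PowerSeries.C Polynomial.X + PowerSeries.X)
  constantCoeff_toAlgHom r := by
    have h : (evalZero C (Polynomial C)).comp
        (Polynomial.aeval (PowerSeries.C Polynomial.X + PowerSeries.X)) = AlgHom.id C _ := by
      apply Polynomial.algHom_ext
      simp [evalZero]
    exact congrArg (fun f : Polynomial C →ₐ[C] Polynomial C => f r) h

/-- The iterative derivation with respect to `t` on `C(t)`, given by `t ↦ t + T`. -/
def ratDerivation : HigherDerivation C (RatFunc C) :=
  (polyDerivation C).localization (nonZeroDivisors (Polynomial C)) (RatFunc C)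

/-- The ring `R` of all `P(t, T, U) ∈ C(t)⟦T, U⟧` with `P(t + U, T, 0) = P(t, T, U)`.
Setting `U = 0` is done in the coefficients of the powers of `T`; then `t ↦ t + U`, which is the
iterative derivation with respect to `t` in the variable `U`, is applied to these coefficients. -/
def shiftRing : Subalgebra C (RatFunc C)⟦X⟧⟦X⟧ :=
  AlgHom.equalizer
    ((PowerSeries.mapAlgHom (ratDerivation C).toAlgHom).comp
      (PowerSeries.mapAlgHom (evalZero C (RatFunc C))))
    (AlgHom.id C (RatFunc C)⟦X⟧⟦X⟧)

/-- The inclusion `C(t) → K(t)` induced by `C → K`. -/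
def ratInclusion (K : Type*) [Field K] [Algebra C K] : RatFunc C →ₐ[C] RatFunc K :=
  RatFunc.mapAlgHom (Polynomial.mapAlgHom (Algebra.ofId C K))
    (nonZeroDivisors_le_comap_nonZeroDivisors_of_injective _
      (Polynomial.map_injective _ (algebraMap C K).injective))

end RationalFunctions

/-! ### Group schemes and their points -/

section Points

variable {C : Type u} [Field C]

/-- `Spec S` as a scheme over `Spec C`. -/
def specOver (C : Type u) [Field C] (S : Type u) [CommRing S] [Algebra C S] :
    Over (Spec (.of C)) :=
  Over.mk (Spec.map (CommRingCat.ofHom (algebraMap C S)))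

/-- The morphism `Spec S' → Spec S` over `Spec C` given by a homomorphism `S → S'`. -/
def specOverMap {S S' : Type u} [CommRing S] [Algebra C S] [CommRing S'] [Algebra C S']
    (f : S →ₐ[C] S') : specOver C S' ⟶ specOver C S :=
  Over.homMk (Spec.map (CommRingCat.ofHom f.toRingHom)) (by
    dsimp [specOver]
    rw [← Spec.map_comp, ← CommRingCat.ofHom_comp]
    congr 2
    exact f.comp_algebraMap)

variable (A : Over (Spec (.of C)))

/-- The set `A(S)` of `S`-valued points of `A`. It is a group if `A` is a group scheme. -/
abbrev Points (S : Type u) [CommRing S] [Algebra C S] : Type u := specOver C S ⟶ A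

/-- The map `f_* : A(S) → A(S')` induced by `f : S → S'`. -/
def Points.map {S S' : Type u} [CommRing S] [Algebra C S] [CommRing S'] [Algebra C S']
    (f : S →ₐ[C] S') (x : Points A S) : Points A S' :=
  specOverMap f ≫ x

variable [IsIntegral A.left]

/-- The function field `K_A`. -/
def FunField : Type u := A.left.functionField

instance : Field (FunField A) := inferInstanceAs (Field A.left.functionField)

/-- The structure of a `C`-algebra on `K_A`, given by the structure morphism `A → Spec C`. -/
instance : Algebra C (FunField A) :=
  RingHom.toAlgebra (Spec.preimage (S := .of (FunField A)) (R := .of C)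
    (A.left.fromSpecStalk (genericPoint A.left) ≫ A.hom)).hom

/-- The generic point, as a `K_A`-valued point. -/
def genericPt : Points A (FunField A) :=
  Over.homMk (A.left.fromSpecStalk (genericPoint A.left)) (by
    exact (Spec.map_preimage _).symm)

/-- `L = K_A(t)`. -/
abbrev FieldL : Type u := RatFunc (FunField A)

/-- `LD = Quot(L ⊗_C D)`, where `D = K_A`. -/
abbrev FieldLD : Type u := FractionRing (FieldL A ⊗[C] FunField A)

/-- The inclusion `L → LD`. -/
def inclL : FieldL A →ₐ[C] FieldLD A :=
  (IsScalarTower.toAlgHom C (FieldL A ⊗[C] FunField A) (FieldLD A)).comp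
    Algebra.TensorProduct.includeLeft

/-- The inclusion `D → LD`. -/
def inclD : FunField A →ₐ[C] FieldLD A :=
  (IsScalarTower.toAlgHom C (FieldL A ⊗[C] FunField A) (FieldLD A)).comp
    Algebra.TensorProduct.includeRight

/-- The higher derivation on `LD` induced by `θ` on `L` and the trivial one on `D`. -/
def derivationLD (θ : HigherDerivation C (FieldL A)) : HigherDerivation C (FieldLD A) :=
  (θ.tensor (HigherDerivation.trivial C (FunField A))).localization
    (nonZeroDivisors (FieldL A ⊗[C] FunField A)) (FieldLD A)

/-- `η_L ∈ A(L)`, the generic point of `A`. -/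
def etaL : Points A (FieldL A) :=
  Points.map A (IsScalarTower.toAlgHom C (FunField A) (FieldL A)) (genericPt A)

/-- `θ` extends the iterative derivation with respect to `t` on `C(t)`. -/
def ExtendsRat (θ : HigherDerivation C (FieldL A)) : Prop :=
  IsHDHom (ratDerivation C) θ (ratInclusion C (FunField A))

/-- `ρ : LD → LD` is induced by the addition of `A`: it fixes `t` and `D`, and on `K_A ⊆ L` it is
the map `K_A → K_{A × A}` induced by `⊕`, that is `ρ_*(η_L) = η_L ⊕ η_D` in `A(LD)`. -/
def IsInducedByAddition [GrpObj A] (ρ : FieldLD A →ₐ[C] FieldLD A) : Prop :=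
  ρ (inclL A RatFunc.X) = inclL A RatFunc.X ∧
  (∀ d : FunField A, ρ (inclD A d) = inclD A d) ∧
  Points.map A (ρ.comp (inclL A)) (etaL A) =
    Points.map A (inclL A) (etaL A) * Points.map A (inclD A) (genericPt A)

/-- The condition `θ_{U,*}(η_L) ⊖ θ_{T+U,*}(η_L) ∈ A(R)`; the inclusion `R ⊆ L⟦T, U⟧` is the one
of `C(t)⟦T, U⟧`. -/
def DifferenceInR [GrpObj A] (θ : HigherDerivation C (FieldL A)) : Prop :=
  ∃ x : Points A (shiftRing C),
    Points.map A ((PowerSeries.mapAlgHom (PowerSeries.mapAlgHom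
      (ratInclusion C (FunField A)))).comp (shiftRing C).val) x =
    Points.map A θ.inU (etaL A) / Points.map A θ.inTU (etaL A)

end Points

end IDGroup

end

/-!
A point of `A` with values in a `C`-algebra `S` that comes from `K_A → S` determines this
homomorphism, since `Spec K_A ⟶ A` is a monomorphism. So homomorphisms out of `L` and `LD` can be
compared through the images of `t`, of `D` and of the generic point, and the theorem becomes a
computation in the groups `A(S)`.

Existence of `ρ`: an affine chart `Spec B` of `A` gives the open subscheme `Spec (B ⊗ B)` of
`A × A`, so `K_A ⊗ K_A` is a domain, with fraction field the function field of `A × A`, and a pair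
of points `(x, y)` over a field hits the generic point of `A × A` exactly if `K_A ⊗ K_A` embeds in
that field (`isDomain_and_generic_iff`). Automorphisms of the scheme `A × A` preserve its generic
point, and hence act on `K_{A × A}` (`exists_endomorphism`) and, fixing `t`, on
`LD = K_{A × A}(t)`. The shear `(x, y) ↦ (x ⊕ y, y)` and its inverse give `ρ` and `ρ⁻¹`.

The equivalence goes through the point `δ = η_L ⊖ θ_*(η_L)` of `A(L⟦T⟧)`.
* `ρ` is an HD-homomorphism if and only if `δ` is `ρ`-invariant, because `η_L ⊕ η_D` and
  `θ_*(η_L) ⊕ η_D` have the same difference as `η_L` and `θ_*(η_L)`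
  (`isHDHom_iff_map_difference`).
* `δ` is `ρ`-invariant if and only if it comes from `A(C(t)⟦T⟧)` (`map_difference_eq_iff`). As
  `L⟦T⟧` is local, `δ` factors through a local ring of `A`, so it suffices to know that the
  elements of `L` fixed by `ρ` are those of `C(t)`. If `f(x ⊕ y) = f(x)`, then `f(y) = f(x)`, and
  `K_A(t) ∩ K_A(t) = C(t)` inside `K_{A × A}(t)`.
* `R` is the image of `C(t)⟦T⟧` under `P(t, T) ↦ P(t + U, T)`. If `θ` is iterative, then `θ_U` maps
  `δ` to `θ_{U,*}(η_L) ⊖ θ_{T+U,*}(η_L)`. Conversely, setting `U = 0` in the latter point gives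
  `δ` back, and then `θ_U ∘ θ_T` and `θ_{T+U}` agree at `η_L`, so that `θ` is iterative
  (`differenceInR_iff`).
-/

open CartesianMonoidalCategory

noncomputable section

namespace IDGroup

universe u

/-! ### Higher derivations and power series -/

section HigherDerivations

variable {C : Type*} [CommRing C] {R S : Type*} [CommRing R] [Algebra C R] [CommRing S]
  [Algebra C S]

/-- `θ` is iterative if and only if `θ_U ∘ θ_T = θ_{T+U}`. -/
theorem HigherDerivation.isIterative_iff_map_comp (θ : HigherDerivation C R) :
    θ.IsIterative ↔ (PowerSeries.mapAlgHom θ.toAlgHom).comp θ.toAlgHom = θ.inTU := by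
  have key : ∀ (i j : ℕ) (r : R),
      PowerSeries.coeff j (PowerSeries.coeff i (θ.inTU r)) =
        (j + i).choose j • PowerSeries.coeff (j + i) (θ.toAlgHom r) := by
    intro i j r
    change PowerSeries.coeff j (PowerSeries.coeff i (addSubstFun (θ.toAlgHom r))) = _
    rw [coeff_addSubstFun, nsmul_eq_mul, add_comm j i, Nat.choose_symm_add]
  constructor
  · intro h
    ext r i j
    rw [key, ← h, AlgHom.comp_apply, PowerSeries.mapAlgHom_apply, PowerSeries.coeff_map]
    rfl
  · intro h j i r
    rw [← key, ← h, AlgHom.comp_apply, PowerSeries.mapAlgHom_apply, PowerSeries.coeff_map]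
    rfl

theorem mapAlgHom_comp {R S S' : Type*} [CommRing R] [Algebra C R] [CommRing S] [Algebra C S]
    [CommRing S'] [Algebra C S'] (f : R →ₐ[C] S) (g : S →ₐ[C] S') :
    (PowerSeries.mapAlgHom g).comp (PowerSeries.mapAlgHom f) =
      PowerSeries.mapAlgHom (g.comp f) := by
  ext r i
  simp [PowerSeries.mapAlgHom_apply]

theorem mapAlgHom_comp_constSeries (f : R →ₐ[C] S) :
    (PowerSeries.mapAlgHom f).comp (constSeries C R) = (constSeries C S).comp f := by
  ext r i
  simp [PowerSeries.mapAlgHom_apply, constSeries_apply]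

theorem HigherDerivation.evalZero_comp (θ : HigherDerivation C R) :
    (evalZero C R).comp θ.toAlgHom = AlgHom.id C R :=
  AlgHom.ext θ.constantCoeff_toAlgHom

theorem mapAlgHom_id : PowerSeries.mapAlgHom (AlgHom.id C R) = AlgHom.id C R⟦X⟧ := by
  ext r i
  simp [PowerSeries.mapAlgHom_apply]

theorem HigherDerivation.map_evalZero_comp_inTU (θ : HigherDerivation C R) :
    (PowerSeries.mapAlgHom (evalZero C R)).comp θ.inTU = θ.toAlgHom := by
  ext r i
  change evalZero C R (PowerSeries.coeff i (addSubstFun (θ.toAlgHom r))) = _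
  change PowerSeries.constantCoeff _ = _
  rw [← PowerSeries.coeff_zero_eq_constantCoeff_apply, coeff_addSubstFun]
  simp

theorem HigherDerivation.map_evalZero_comp_inU (θ : HigherDerivation C R) :
    (PowerSeries.mapAlgHom (evalZero C R)).comp θ.inU = constSeries C R := by
  rw [HigherDerivation.inU, ← AlgHom.comp_assoc, mapAlgHom_comp_constSeries, AlgHom.comp_assoc,
    θ.evalZero_comp, AlgHom.comp_id]

theorem addSubst_comp_constSeries :
    (addSubst C R).comp (constSeries C R) = (constSeries C R⟦X⟧).comp (constSeries C R) :=
  AlgHom.ext addSubstFun_C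

theorem mapAlgHom_map_comp_addSubst (f : R →ₐ[C] S) :
    (PowerSeries.mapAlgHom (PowerSeries.mapAlgHom f)).comp (addSubst C R) =
      (addSubst C S).comp (PowerSeries.mapAlgHom f) := by
  ext r i j
  change f (PowerSeries.coeff j (PowerSeries.coeff i (addSubstFun r))) =
    PowerSeries.coeff j (PowerSeries.coeff i (addSubstFun (PowerSeries.mapAlgHom f r)))
  rw [coeff_addSubstFun, coeff_addSubstFun, map_mul, map_natCast, PowerSeries.mapAlgHom_apply,
    PowerSeries.coeff_map]
  rfl

theorem addSubstFun_X :
    addSubstFun (PowerSeries.X : R⟦X⟧) = PowerSeries.X + PowerSeries.C PowerSeries.X := by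
  ext i j
  rw [coeff_addSubstFun, map_add, map_add, PowerSeries.coeff_X, PowerSeries.coeff_X,
    PowerSeries.coeff_C]
  rcases i with _ | _ | i <;> rcases j with _ | _ | j <;>
    simp [PowerSeries.coeff_X, PowerSeries.coeff_one]; omega

end HigherDerivations

/-! ### Rational functions over two copies of a field -/

section RationalFunctions

variable {C : Type*} [Field C] {K E : Type*} [Field K] [Algebra C K] [Field E] [Algebra C E]

/-- The homomorphism `K(t) → E(t)` which is `f` on `K` and fixes `t`. -/
def ratMap (f : K →ₐ[C] E) : RatFunc K →ₐ[C] RatFunc E :=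
  RatFunc.mapAlgHom (Polynomial.mapAlgHom f)
    (nonZeroDivisors_le_comap_nonZeroDivisors_of_injective _
      (Polynomial.map_injective _ f.toRingHom.injective))

theorem ratInclusion_eq_ratMap : ratInclusion C K = ratMap (Algebra.ofId C K) := rfl

theorem ratMap_div (f : K →ₐ[C] E) (p q : Polynomial K) :
    ratMap f (algebraMap _ _ p / algebraMap _ _ q) =
      algebraMap _ _ (p.map (f : K →+* E)) / algebraMap _ _ (q.map (f : K →+* E)) :=
  RatFunc.map_apply_div (Polynomial.mapAlgHom f)
    (nonZeroDivisors_le_comap_nonZeroDivisors_of_injective _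
      (Polynomial.map_injective _ f.toRingHom.injective)) p q

theorem ratMap_algebraMap (f : K →ₐ[C] E) (p : Polynomial K) :
    ratMap f (algebraMap _ _ p) = algebraMap _ _ (p.map (f : K →+* E)) := by
  simpa using ratMap_div f p 1

theorem ratMap_X (f : K →ₐ[C] E) : ratMap f RatFunc.X = RatFunc.X := by
  simpa using ratMap_algebraMap f Polynomial.X

theorem ratMap_comp_toAlgHom (f : K →ₐ[C] E) :
    (ratMap f).comp (IsScalarTower.toAlgHom C K (RatFunc K)) =
      (IsScalarTower.toAlgHom C E (RatFunc E)).comp f := by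
  ext a
  simpa [RatFunc.algebraMap_eq_C] using ratMap_algebraMap f (Polynomial.C a)

theorem ratFunc_algHom_ext {S : Type*} [CommRing S] [Algebra C S] {f g : RatFunc K →ₐ[C] S}
    (hX : f RatFunc.X = g RatFunc.X)
    (hK : f.comp (IsScalarTower.toAlgHom C K (RatFunc K)) =
      g.comp (IsScalarTower.toAlgHom C K (RatFunc K))) : f = g := by
  apply AlgHom.coe_ringHom_injective
  apply IsLocalization.ringHom_ext (nonZeroDivisors (Polynomial K))
  apply Polynomial.ringHom_ext
  · intro a
    simpa [RatFunc.algebraMap_eq_C] using DFunLike.congr_fun hK a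
  · simpa using hX

/-- Reduced fractions with monic denominators are unique. -/
theorem eq_and_eq_of_div_eq_div {p q p' q' : Polynomial K} (hq : q.Monic) (hq' : q'.Monic)
    (h : IsCoprime p q) (h' : IsCoprime p' q')
    (e : algebraMap (Polynomial K) (RatFunc K) p / algebraMap _ _ q =
      algebraMap _ _ p' / algebraMap _ _ q') : p = p' ∧ q = q' := by
  rw [div_eq_div_iff (RatFunc.algebraMap_ne_zero hq.ne_zero)
    (RatFunc.algebraMap_ne_zero hq'.ne_zero), ← map_mul, ← map_mul] at e
  replace e := RatFunc.algebraMap_injective _ e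
  have h1 : q ∣ q' := h.symm.dvd_of_dvd_mul_left (e ▸ Dvd.intro_left _ rfl)
  have h2 : q' ∣ q := h'.symm.dvd_of_dvd_mul_left (e ▸ Dvd.intro_left _ rfl)
  have h3 : q = q' := Polynomial.eq_of_monic_of_associated hq hq' (associated_of_dvd_dvd h1 h2)
  subst h3
  exact ⟨mul_right_cancel₀ hq.ne_zero e, rfl⟩

/-- `K ∩ K = C` inside `K ⊗ K`, and so inside any `E` in which the two copies of `K` are linearly
disjoint. -/
theorem mem_range_of_injective_productMap {i j : K →ₐ[C] E}
    (hij : Function.Injective (Algebra.TensorProduct.productMap i j)) {a : K} (h : i a = j a) :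
    a ∈ Set.range (algebraMap C K) := by
  have h1 : a ⊗ₜ[C] (1 : K) = 1 ⊗ₜ[C] a := hij (by simpa using h)
  obtain ⟨g, hg⟩ := (Algebra.linearMap C K).exists_leftInverse_of_injective
    (LinearMap.ker_eq_bot.2 (algebraMap C K).injective)
  -- Applying a retraction `g` of `C → K` to the second factor of `a ⊗ 1 = 1 ⊗ a` gives `a = g(a)`.
  have hg1 : g 1 = 1 := by simpa using DFunLike.congr_fun hg 1
  have h2 := congrArg (fun z => TensorProduct.rid C K (g.lTensor K z)) h1
  refine ⟨g a, ?_⟩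
  simpa [hg1, Algebra.smul_def] using h2.symm

/-- `K(t) ∩ K(t) = C(t)` inside `E(t)`, if `K ⊗ K` embeds in `E`. -/
theorem mem_range_ratInclusion {i j : K →ₐ[C] E}
    (hij : Function.Injective (Algebra.TensorProduct.productMap i j)) {f : RatFunc K}
    (h : ratMap i f = ratMap j f) : f ∈ Set.range (ratInclusion C K) := by
  -- The reduced fraction of `f` stays reduced with a monic denominator under `i` and `j`.
  have hcop : ∀ k : K →ₐ[C] E,
      IsCoprime (f.num.map (k : K →+* E)) (f.denom.map (k : K →+* E)) :=
    fun k => f.isCoprime_num_denom.map (Polynomial.mapRingHom (k : K →+* E))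
  rw [← RatFunc.num_div_denom f, ratMap_div, ratMap_div] at h
  obtain ⟨hn, hd⟩ := eq_and_eq_of_div_eq_div (f.monic_denom.map _) (f.monic_denom.map _)
    (hcop i) (hcop j) h
  have lift : ∀ p : Polynomial K, p.map (i : K →+* E) = p.map (j : K →+* E) →
      ∃ q : Polynomial C, q.map (algebraMap C K) = p := by
    intro p hp
    rw [← Polynomial.mem_lifts, Polynomial.lifts_iff_coeff_lifts]
    intro n
    refine mem_range_of_injective_productMap hij ?_
    simpa using congrArg (fun q => q.coeff n) hp
  obtain ⟨n, hn⟩ := lift _ hn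
  obtain ⟨d, hd⟩ := lift _ hd
  refine ⟨algebraMap _ _ n / algebraMap _ _ d, ?_⟩
  rw [ratInclusion_eq_ratMap, ratMap_div]
  change algebraMap _ _ (n.map (algebraMap C K)) / algebraMap _ _ (d.map (algebraMap C K)) = f
  rw [hn, hd, RatFunc.num_div_denom]

end RationalFunctions

/-! ### The fraction field of `K(t) ⊗ D` -/

section Composite

variable {C : Type*} [Field C] {K D E : Type*} [Field K] [Algebra C K] [Field D] [Algebra C D]
  [Field E] [Algebra C E]

theorem productMap_comp_include {F : Type*} [CommRing F] [Algebra C F] (g : K ⊗[C] D →ₐ[C] F) :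
    Algebra.TensorProduct.productMap (g.comp Algebra.TensorProduct.includeLeft)
      (g.comp Algebra.TensorProduct.includeRight) = g := by
  apply Algebra.TensorProduct.ext <;> ext <;> simp [← Algebra.TensorProduct.one_def]

/-- The homomorphism `(K ⊗ D)[t] → K(t) ⊗ D`. -/
def polyToTensor (C K D : Type*) [Field C] [Field K] [Algebra C K] [Field D] [Algebra C D] :
    Polynomial (K ⊗[C] D) →+* RatFunc K ⊗[C] D :=
  Polynomial.eval₂RingHom (Algebra.TensorProduct.map (IsScalarTower.toAlgHom C K (RatFunc K))
    (AlgHom.id C D)).toRingHom (RatFunc.X ⊗ₜ 1)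

/-- Every element of `K(t) ⊗ D` has a denominator in `K[t]`. -/
theorem exists_mul_eq_polyToTensor (z : RatFunc K ⊗[C] D) :
    ∃ q : Polynomial K, q ≠ 0 ∧ ∃ P : Polynomial (K ⊗[C] D),
      (algebraMap _ (RatFunc K) q ⊗ₜ 1) * z = polyToTensor C K D P := by
  have left : ∀ q : Polynomial K, polyToTensor C K D
      (q.map (Algebra.TensorProduct.includeLeft : K →ₐ[C] K ⊗[C] D).toRingHom) =
        algebraMap _ (RatFunc K) q ⊗ₜ 1 := by
    intro q
    have : (polyToTensor C K D).comp (Polynomial.mapRingHom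
        (Algebra.TensorProduct.includeLeft : K →ₐ[C] K ⊗[C] D).toRingHom) =
        (Algebra.TensorProduct.includeLeft : RatFunc K →ₐ[C] RatFunc K ⊗[C] D).toRingHom.comp
          (algebraMap (Polynomial K) (RatFunc K)) := by
      apply Polynomial.ringHom_ext <;> simp [polyToTensor, RatFunc.algebraMap_eq_C]
    exact DFunLike.congr_fun this q
  induction z with
  | zero => exact ⟨1, one_ne_zero, 0, by simp⟩
  | tmul f d =>
    refine ⟨f.denom, f.denom_ne_zero, f.num.map
      (Algebra.TensorProduct.includeLeft : K →ₐ[C] K ⊗[C] D).toRingHom *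
        Polynomial.C (1 ⊗ₜ d), ?_⟩
    have hf : algebraMap (Polynomial K) (RatFunc K) f.denom * f = algebraMap _ _ f.num := by
      rw [mul_comm, ← eq_div_iff (RatFunc.algebraMap_ne_zero f.denom_ne_zero), f.num_div_denom]
    rw [map_mul, left]
    simp [polyToTensor, hf]
  | add x y hx hy =>
    obtain ⟨q, hq, P, hP⟩ := hx
    obtain ⟨q', hq', P', hP'⟩ := hy
    refine ⟨q * q', mul_ne_zero hq hq',
      q'.map (Algebra.TensorProduct.includeLeft : K →ₐ[C] K ⊗[C] D).toRingHom * P +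
      q.map (Algebra.TensorProduct.includeLeft : K →ₐ[C] K ⊗[C] D).toRingHom * P', ?_⟩
    have hqq : (algebraMap _ (RatFunc K) (q * q') ⊗ₜ[C] (1 : D)) =
        (algebraMap _ (RatFunc K) q ⊗ₜ 1) * (algebraMap _ (RatFunc K) q' ⊗ₜ 1) := by simp
    rw [hqq, map_add, map_mul (polyToTensor C K D), map_mul (polyToTensor C K D), left, left, ← hP,
      ← hP']
    ring

/-- The homomorphism `K(t) ⊗ D → E(t)` given by `K → E` and `D → E`. -/
def tensorToRatFunc (i : K →ₐ[C] E) (j : D →ₐ[C] E) : RatFunc K ⊗[C] D →ₐ[C] RatFunc E :=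
  Algebra.TensorProduct.productMap (ratMap i) ((IsScalarTower.toAlgHom C E (RatFunc E)).comp j)

theorem tensorToRatFunc_polyToTensor (i : K →ₐ[C] E) (j : D →ₐ[C] E)
    (P : Polynomial (K ⊗[C] D)) :
    tensorToRatFunc i j (polyToTensor C K D P) =
      algebraMap _ _ (P.map (Algebra.TensorProduct.productMap i j).toRingHom) := by
  have : (tensorToRatFunc i j).toRingHom.comp (polyToTensor C K D) =
      (algebraMap (Polynomial E) (RatFunc E)).comp
        (Polynomial.mapRingHom (Algebra.TensorProduct.productMap i j).toRingHom) := by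
    apply Polynomial.ringHom_ext
    · intro z
      induction z with
      | zero => simp
      | add x y hx hy => simp only [map_add, hx, hy]
      | tmul a d =>
        have := DFunLike.congr_fun (ratMap_comp_toAlgHom i) a
        simp only [AlgHom.comp_apply, IsScalarTower.coe_toAlgHom', RatFunc.algebraMap_eq_C] at this
        simp [polyToTensor, tensorToRatFunc, this, RatFunc.algebraMap_eq_C]
    · simp [polyToTensor, tensorToRatFunc, ratMap_X]
  exact DFunLike.congr_fun this P

theorem tensorToRatFunc_injective {i : K →ₐ[C] E} {j : D →ₐ[C] E}
    (hij : Function.Injective (Algebra.TensorProduct.productMap i j)) :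
    Function.Injective (tensorToRatFunc i j) := by
  rw [injective_iff_map_eq_zero]
  intro z hz
  obtain ⟨q, hq, P, hP⟩ := exists_mul_eq_polyToTensor z
  have h0 := tensorToRatFunc_polyToTensor i j P
  rw [← hP, map_mul, hz, mul_zero, eq_comm, map_eq_zero_iff _ (RatFunc.algebraMap_injective E),
    Polynomial.map_eq_zero_iff hij] at h0
  rw [h0, map_zero] at hP
  have hu : IsUnit (algebraMap _ (RatFunc K) q ⊗ₜ[C] (1 : D)) :=
    (IsUnit.mk0 _ (RatFunc.algebraMap_ne_zero hq)).map
      (Algebra.TensorProduct.includeLeft : RatFunc K →ₐ[C] RatFunc K ⊗[C] D)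
  exact hu.mul_right_eq_zero.1 hP

theorem isDomain_ratFunc_tensor [IsDomain (K ⊗[C] D)] : IsDomain (RatFunc K ⊗[C] D) := by
  let i : K →ₐ[C] FractionRing (K ⊗[C] D) :=
    (IsScalarTower.toAlgHom C (K ⊗[C] D) _).comp Algebra.TensorProduct.includeLeft
  let j : D →ₐ[C] FractionRing (K ⊗[C] D) :=
    (IsScalarTower.toAlgHom C (K ⊗[C] D) _).comp Algebra.TensorProduct.includeRight
  have h : Algebra.TensorProduct.productMap i j = IsScalarTower.toAlgHom C (K ⊗[C] D) _ :=
    productMap_comp_include _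
  have hij : Function.Injective (Algebra.TensorProduct.productMap i j) := by
    rw [h]
    exact IsFractionRing.injective _ _
  exact (tensorToRatFunc_injective hij).isDomain (tensorToRatFunc i j).toRingHom

/-- `Quot(K(t) ⊗ D) = E(t)`, if `E = Quot(K ⊗ D)`. -/
theorem exists_fractionRing_algEquiv [Algebra (K ⊗[C] D) E] [IsScalarTower C (K ⊗[C] D) E]
    [IsFractionRing (K ⊗[C] D) E] :
    ∃ e : FractionRing (RatFunc K ⊗[C] D) ≃ₐ[C] RatFunc E, ∀ z, e (algebraMap _ _ z) =
      tensorToRatFunc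
        ((IsScalarTower.toAlgHom C (K ⊗[C] D) E).comp Algebra.TensorProduct.includeLeft)
        ((IsScalarTower.toAlgHom C (K ⊗[C] D) E).comp Algebra.TensorProduct.includeRight) z := by
  set i := (IsScalarTower.toAlgHom C (K ⊗[C] D) E).comp Algebra.TensorProduct.includeLeft
  set j := (IsScalarTower.toAlgHom C (K ⊗[C] D) E).comp Algebra.TensorProduct.includeRight
  have h : Algebra.TensorProduct.productMap i j = IsScalarTower.toAlgHom C (K ⊗[C] D) E :=
    productMap_comp_include _
  have hij : Function.Injective (Algebra.TensorProduct.productMap i j) := by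
    rw [h]
    exact IsFractionRing.injective _ _
  have : IsDomain (K ⊗[C] D) := hij.isDomain (Algebra.TensorProduct.productMap i j).toRingHom
  have := isDomain_ratFunc_tensor (C := C) (K := K) (D := D)
  let m : FractionRing (RatFunc K ⊗[C] D) →ₐ[C] RatFunc E :=
    IsFractionRing.liftAlgHom (g := tensorToRatFunc i j) (tensorToRatFunc_injective hij)
  have hm : ∀ z, m (algebraMap _ _ z) = tensorToRatFunc i j z := fun z =>
    IsFractionRing.lift_algebraMap (g := (tensorToRatFunc i j).toRingHom)
      (tensorToRatFunc_injective hij) z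
  -- The image of `m` is a subfield that contains the polynomials over `K ⊗ D`.
  have hpoly : ∀ p : Polynomial E, ∃ x, m x = algebraMap _ _ p := by
    intro p
    induction p using Polynomial.induction_on' with
    | add p q hp hq =>
      obtain ⟨x, hx⟩ := hp
      obtain ⟨y, hy⟩ := hq
      exact ⟨x + y, by rw [map_add, map_add, hx, hy]⟩
    | monomial n a =>
      obtain ⟨b, c, hc, rfl⟩ := IsFractionRing.div_surjective (A := K ⊗[C] D) a
      refine ⟨algebraMap _ _ (polyToTensor C K D (Polynomial.monomial n b)) /
        algebraMap _ _ (polyToTensor C K D (Polynomial.C c)), ?_⟩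
      rw [map_div₀, hm, hm, tensorToRatFunc_polyToTensor, tensorToRatFunc_polyToTensor, h]
      have hc' : algebraMap (K ⊗[C] D) E c ≠ 0 :=
        IsFractionRing.to_map_ne_zero_of_mem_nonZeroDivisors hc
      rw [div_eq_iff (RatFunc.algebraMap_ne_zero (by simpa using hc')), ← map_mul]
      congr 1
      simp [Polynomial.monomial_mul_C, div_mul_cancel₀ _ hc']
  have hsurj : Function.Surjective m := by
    intro f
    obtain ⟨x, hx⟩ := hpoly f.num
    obtain ⟨y, hy⟩ := hpoly f.denom
    exact ⟨x / y, by rw [map_div₀, hx, hy, RatFunc.num_div_denom]⟩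
  exact ⟨AlgEquiv.ofBijective m ⟨m.toRingHom.injective, hsurj⟩, hm⟩

end Composite

/-! ### Points of a scheme with values in an algebra -/

section Points

variable {C : Type u} [Field C] (A : Over (Spec (.of C)))
variable {S S' S'' : Type u} [CommRing S] [Algebra C S] [CommRing S'] [Algebra C S']
  [CommRing S''] [Algebra C S'']

variable {A} in
/-- The morphism of schemes `Spec S ⟶ A` underlying an `S`-valued point. -/
def Points.hom (x : Points A S) : Spec (.of S) ⟶ A.left := x.left

variable {A} in
theorem Points.hom_ext {x y : Points A S} (h : x.hom = y.hom) : x = y :=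
  Over.OverMorphism.ext h

theorem Points.map_hom (f : S →ₐ[C] S') (x : Points A S) :
    (Points.map A f x).hom = Spec.map (CommRingCat.ofHom f.toRingHom) ≫ x.hom := rfl

theorem Points.hom_comp (x : Points A S) :
    x.hom ≫ A.hom = Spec.map (CommRingCat.ofHom (algebraMap C S)) := Over.w x

theorem Points.map_comp (f : S →ₐ[C] S') (g : S' →ₐ[C] S'') (x : Points A S) :
    Points.map A (g.comp f) x = Points.map A g (Points.map A f x) := by
  apply Points.hom_ext
  rw [Points.map_hom, Points.map_hom, Points.map_hom, ← Category.assoc, ← Spec.map_comp]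
  rfl

theorem Points.map_mul [GrpObj A] (f : S →ₐ[C] S') (x y : Points A S) :
    Points.map A f (x * y) = Points.map A f x * Points.map A f y :=
  MonObj.comp_mul _ _ _

theorem Points.map_div [GrpObj A] (f : S →ₐ[C] S') (x y : Points A S) :
    Points.map A f (x / y) = Points.map A f x / Points.map A f y :=
  GrpObj.comp_div _ _ _

theorem Points.map_injective_of_mono (x : Points A S) [Mono x.hom] {f g : S →ₐ[C] S'}
    (h : Points.map A f x = Points.map A g x) : f = g := by
  have h1 := congrArg Points.hom h
  rw [Points.map_hom, Points.map_hom, cancel_mono] at h1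
  exact AlgHom.coe_ringHom_injective (congrArg CommRingCat.Hom.hom (Spec.map_injective h1))

theorem Points.exists_algHom (x : Points A S) (y : Points A S') (φ : S →+* S')
    (h : Spec.map (CommRingCat.ofHom φ) ≫ x.hom = y.hom) :
    ∃ f : S →ₐ[C] S', f.toRingHom = φ ∧ Points.map A f x = y := by
  have h1 : φ.comp (algebraMap C S) = algebraMap C S' := by
    have hy := y.hom_comp
    rw [← h, Category.assoc, x.hom_comp, ← Spec.map_comp] at hy
    exact congrArg CommRingCat.Hom.hom (Spec.map_injective hy)
  exact ⟨{ φ with commutes' := fun c => DFunLike.congr_fun h1 c }, rfl, Points.hom_ext h⟩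

/-- A morphism of schemes `Spec S ⟶ A` is an `S`-valued point, for a suitable structure of a
`C`-algebra on `S`. -/
theorem Points.exists_algebra (S : CommRingCat.{u}) (g : Spec S ⟶ A.left) :
    ∃ (_ : Algebra C S) (x : Points A S), x.hom = g := by
  let _ : Algebra C S := (Spec.preimage (S := S) (R := .of C) (g ≫ A.hom)).hom.toAlgebra
  exact ⟨inferInstance, Over.homMk g (Spec.map_preimage _).symm, rfl⟩

/-- A point with values in a local ring factors through a monomorphism from an affine scheme,
namely the spectrum of the local ring of `A` at the image of the closed point. -/
theorem Points.exists_eq_map_of_isLocalRing [IsLocalRing S] (x : Points A S) :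
    ∃ (R : Type u) (_ : CommRing R) (_ : Algebra C R) (y : Points A R) (f : R →ₐ[C] S),
      Mono y.hom ∧ Points.map A f y = x := by
  let P : A.left := x.hom (IsLocalRing.closedPoint S)
  obtain ⟨_, y, hy⟩ := Points.exists_algebra A (A.left.presheaf.stalk P) (A.left.fromSpecStalk P)
  obtain ⟨f, -, hf⟩ := Points.exists_algHom A y x
    (Scheme.stalkClosedPointTo (R := .of S) x.hom).hom (by
      rw [hy]
      exact Scheme.Spec_stalkClosedPointTo_fromSpecStalk (R := .of S) x.hom)
  have : Mono (A.left.fromSpecStalk P) := inferInstance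
  exact ⟨_, _, _, y, f, hy ▸ this, hf⟩

/-- A point over a local ring `S` on which `g` and `h` agree descends to a subring that contains all
elements of `S` on which `g` and `h` agree. -/
theorem Points.mem_range_map_of_isLocalRing [IsLocalRing S] {g h : S →ₐ[C] S'}
    {i : S'' →ₐ[C] S} (hi : Function.Injective i) (hgh : ∀ s, g s = h s → s ∈ Set.range i)
    {x : Points A S} (hx : Points.map A g x = Points.map A h x) :
    ∃ y : Points A S'', Points.map A i y = x := by
  obtain ⟨R, _, _, y, f, _, rfl⟩ := Points.exists_eq_map_of_isLocalRing A x
  rw [← Points.map_comp, ← Points.map_comp] at hx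
  have h1 := Points.map_injective_of_mono A y hx
  have h2 : f.range ≤ i.range := by
    rintro _ ⟨r, rfl⟩
    exact hgh _ (DFunLike.congr_fun h1 r)
  let k : R →ₐ[C] S'' := ((AlgEquiv.ofInjective i hi).symm.toAlgHom.comp
    (Subalgebra.inclusion h2)).comp f.rangeRestrict
  refine ⟨Points.map A k y, ?_⟩
  rw [← Points.map_comp]
  congr 1
  ext r
  exact congrArg Subtype.val ((AlgEquiv.ofInjective i hi).apply_symm_apply
    (Subalgebra.inclusion h2 (f.rangeRestrict r)))

variable [IsIntegral A.left]

instance : Mono (genericPt A).hom :=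
  inferInstanceAs (Mono (A.left.fromSpecStalk (genericPoint A.left)))

/-- A point over a field that hits the generic point of `A` comes from `K_A`. -/
theorem exists_map_genericPt {F : Type u} [Field F] [Algebra C F] (x : Points A F)
    (hx : x.hom (IsLocalRing.closedPoint F) = genericPoint A.left) :
    ∃ f : FunField A →ₐ[C] F, Points.map A f (genericPt A) = x := by
  have : ∀ P : A.left, x.hom (IsLocalRing.closedPoint F) = P →
      ∃ φ : A.left.presheaf.stalk P ⟶ .of F, Spec.map φ ≫ A.left.fromSpecStalk P = x.hom := by
    rintro _ rfl
    exact ⟨_, Scheme.Spec_stalkClosedPointTo_fromSpecStalk (R := .of F) x.hom⟩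
  obtain ⟨φ, hφ⟩ := this _ hx
  obtain ⟨f, -, hf⟩ := Points.exists_algHom A (genericPt A) x φ.hom hφ
  exact ⟨f, hf⟩

/-- There is a nonempty affine open subscheme `Spec B` of `A`; its ring has fraction field `K_A`. -/
theorem exists_affine_chart : ∃ (B : Type u) (_ : CommRing B) (_ : Algebra C B) (x : Points A B)
    (h : B →ₐ[C] FunField A), IsOpenImmersion x.hom ∧ Points.map A h x = genericPt A ∧
      Function.Injective h ∧ ∀ k, ∃ b : B, h b ≠ 0 ∧ h b * k ∈ Set.range h := by
  obtain ⟨_, ⟨U, hU, rfl⟩, hxU, -⟩ := A.left.isBasis_affineOpens.exists_subset_of_mem_open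
    (Set.mem_univ (genericPoint A.left)) isOpen_univ
  have : Nonempty U := ⟨⟨_, hxU⟩⟩
  obtain ⟨_, x, hx⟩ := Points.exists_algebra A Γ(A.left, U) hU.fromSpec
  obtain ⟨h, hh, hx'⟩ := Points.exists_algHom A x (genericPt A)
    (A.left.presheaf.germ U _ hxU).hom (by
      rw [hx]
      exact hU.fromSpecStalk_eq_fromSpecStalk hxU)
  have hfrac := functionField_isFractionRing_of_isAffineOpen A.left U hU
  have hinj : Function.Injective h := by
    have := A.left.germToFunctionField_injective U
    exact fun a b hab => this ((DFunLike.congr_fun hh a).symm.trans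
      (hab.trans (DFunLike.congr_fun hh b)))
  have hopen := IsAffineOpen.isOpenImmersion_fromSpec hU
  refine ⟨_, _, _, x, h, hx ▸ hopen, hx', hinj, fun k => ?_⟩
  obtain ⟨a, b, hb, e⟩ := IsFractionRing.div_surjective (A := Γ(A.left, U))
    (K := A.left.functionField) k
  have hb' := IsFractionRing.to_map_ne_zero_of_mem_nonZeroDivisors (K := A.left.functionField) hb
  have key : ∀ c, h c = algebraMap Γ(A.left, U) A.left.functionField c := fun c =>
    DFunLike.congr_fun hh c
  refine ⟨b, by rw [key]; exact hb', a, ?_⟩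
  rw [key, key, ← e]
  exact (mul_div_cancel₀ _ hb').symm

end Points

/-! ### Tensor squares of rings of fractions -/

section Tensor

variable {C : Type*} [Field C] {B K : Type*} [CommRing B] [Algebra C B] [Field K] [Algebra C K]

/-- If `K` is a ring of fractions of `B`, then so is `K ⊗ K` of `B ⊗ B`. That the denominator `s`
comes from `B ⊗ B` is part of the statement since the denominators of two summands get
multiplied. -/
theorem exists_isUnit_mul_mem_range {h : B →ₐ[C] K}
    (hh : ∀ k, ∃ b : B, h b ≠ 0 ∧ h b * k ∈ Set.range h) (z : K ⊗[C] K) :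
    ∃ s : K ⊗[C] K, IsUnit s ∧ s * z ∈ (Algebra.TensorProduct.map h h).range ∧
      s ∈ (Algebra.TensorProduct.map h h).range := by
  induction z with
  | zero => exact ⟨1, isUnit_one, by simp, one_mem _⟩
  | tmul a b =>
    obtain ⟨x, hx, x', hx'⟩ := hh a
    obtain ⟨y, hy, y', hy'⟩ := hh b
    refine ⟨h x ⊗ₜ h y, ?_, ⟨x' ⊗ₜ y', by simp [hx', hy']⟩, ⟨x ⊗ₜ y, by simp⟩⟩
    refine IsUnit.of_mul_eq_one ((h x)⁻¹ ⊗ₜ (h y)⁻¹) ?_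
    simp [hx, hy, Algebra.TensorProduct.one_def]
  | add z w hz hw =>
    obtain ⟨s, hs, hsz, hs'⟩ := hz
    obtain ⟨t, ht, htw, ht'⟩ := hw
    refine ⟨s * t, hs.mul ht, ?_, mul_mem hs' ht'⟩
    rw [show s * t * (z + w) = t * (s * z) + s * (t * w) by ring]
    exact add_mem (mul_mem ht' hsz) (mul_mem hs' htw)

theorem tensorMap_injective {h : B →ₐ[C] K} (hinj : Function.Injective h) :
    Function.Injective (Algebra.TensorProduct.map h h) :=
  TensorProduct.map_injective_of_flat_flat h.toLinearMap h.toLinearMap hinj hinj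

end Tensor

/-! ### The generic point of the product -/

section GenericPairs

variable {C : Type u} [Field C] (A : Over (Spec (.of C)))

/-- Via a chart `Spec B ⟶ A`, the scheme `Spec (B ⊗ B)` is an open subscheme of `A × A`. -/
theorem isOpenImmersion_lift {B : Type u} [CommRing B] [Algebra C B] (x : Points A B)
    [IsOpenImmersion x.hom] :
    IsOpenImmersion (Points.hom (lift
      (Points.map A (Algebra.TensorProduct.includeLeft : B →ₐ[C] B ⊗[C] B) x)
      (Points.map A (Algebra.TensorProduct.includeRight : B →ₐ[C] B ⊗[C] B) x))) := by
  set a := Points.map A (Algebra.TensorProduct.includeLeft : B →ₐ[C] B ⊗[C] B) x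
  set b := Points.map A (Algebra.TensorProduct.includeRight : B →ₐ[C] B ⊗[C] B) x
  have : Points.hom (lift a b) =
      (pullbackSpecIso C B B).inv ≫ Limits.pullback.map _ _ A.hom A.hom x.hom x.hom (𝟙 _)
        (by rw [Category.comp_id, x.hom_comp]) (by rw [Category.comp_id, x.hom_comp]) := by
    apply Limits.pullback.hom_ext
    · rw [Category.assoc, Limits.pullback.lift_fst, pullbackSpecIso_inv_fst_assoc]
      exact congrArg Points.hom (lift_fst a b)
    · rw [Category.assoc, Limits.pullback.lift_snd, pullbackSpecIso_inv_snd_assoc]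
      exact congrArg Points.hom (lift_snd a b)
  rw [this]
  infer_instance

variable [IsIntegral A.left] [IsIntegral (A ⊗ A).left]

/-- `K_A ⊗ K_A` is a domain, and two homomorphisms `f, g : K_A → F` to a field give the generic
point of `A × A` if and only if `K_A ⊗ K_A` embeds in `F`. Both hold because `B ⊗ B`, for an affine
chart `Spec B` of `A`, is the ring of an affine open subscheme of `A × A`. -/
theorem isDomain_and_generic_iff : IsDomain (FunField A ⊗[C] FunField A) ∧
    ∀ (F : Type u) [Field F] [Algebra C F] (f g : FunField A →ₐ[C] F),
      Points.hom (lift (Points.map A f (genericPt A)) (Points.map A g (genericPt A)))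
        (IsLocalRing.closedPoint F) = genericPoint (A ⊗ A).left ↔
      Function.Injective (Algebra.TensorProduct.productMap f g) := by
  obtain ⟨B, _, _, x, h, _, hx, hinj, hfrac⟩ := exists_affine_chart A
  have hmap := tensorMap_injective hinj
  have : Nontrivial (B ⊗[C] B) :=
    (Algebra.TensorProduct.map h h).toRingHom.domain_nontrivial
  have := isOpenImmersion_lift A x
  set w : Points (A ⊗ A) (B ⊗[C] B) := lift
      (Points.map A (Algebra.TensorProduct.includeLeft : B →ₐ[C] B ⊗[C] B) x)
      (Points.map A (Algebra.TensorProduct.includeRight : B →ₐ[C] B ⊗[C] B) x)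
  have hint : IsIntegral (Spec (.of (B ⊗[C] B))) := isIntegral_of_isOpenImmersion w.hom
  have hdom : IsDomain (B ⊗[C] B) := (affine_isIntegral_iff _).1 hint
  have key := exists_isUnit_mul_mem_range hfrac
  refine ⟨?_, fun F _ _ f g => ?_⟩
  · refine (@isDomain_iff_noZeroDivisors_and_nontrivial _ _).2 ⟨⟨fun {a b} hab => ?_⟩, ?_⟩
    · obtain ⟨s, hs, ⟨a', ha'⟩, -⟩ := key a
      obtain ⟨t, ht, ⟨b', hb'⟩, -⟩ := key b
      have h0 : a' * b' = 0 := by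
        apply hmap
        rw [_root_.map_mul, map_zero]
        change (Algebra.TensorProduct.map h h) a' = _ at ha'
        change (Algebra.TensorProduct.map h h) b' = _ at hb'
        rw [ha', hb', show s * a * (t * b) = s * t * (a * b) by ring, hab, mul_zero]
      rcases mul_eq_zero.1 h0 with rfl | rfl
      · left
        rw [map_zero, eq_comm, hs.mul_right_eq_zero] at ha'
        exact ha'
      · right
        rw [map_zero, eq_comm, ht.mul_right_eq_zero] at hb'
        exact hb'
    · infer_instance
  · set m := Algebra.TensorProduct.productMap f g
    set m' := m.comp (Algebra.TensorProduct.map h h)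
    have h1 : Points.map A f (genericPt A) =
        Points.map A m' (Points.map A Algebra.TensorProduct.includeLeft x) := by
      rw [← hx, ← Points.map_comp, ← Points.map_comp]
      congr 1
      ext b
      simp [m', m]
    have h2 : Points.map A g (genericPt A) =
        Points.map A m' (Points.map A Algebra.TensorProduct.includeRight x) := by
      rw [← hx, ← Points.map_comp, ← Points.map_comp]
      congr 1
      ext b
      simp [m', m]
    have h3 : lift (Points.map A f (genericPt A)) (Points.map A g (genericPt A)) =
        Points.map (A ⊗ A) m' w := by
      rw [h1, h2]
      exact (comp_lift _ _ _).symm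
    have h4 : Function.Injective m' ↔ Function.Injective m := by
      refine ⟨fun hm' => ?_, fun hm => hm.comp hmap⟩
      rw [injective_iff_map_eq_zero] at hm' ⊢
      intro z hz
      obtain ⟨s, hs, ⟨z', hz'⟩, -⟩ := key z
      change (Algebra.TensorProduct.map h h) z' = _ at hz'
      have := hm' z' (by
        change m (Algebra.TensorProduct.map h h z') = 0
        rw [hz', _root_.map_mul, hz, mul_zero])
      rw [this, map_zero, eq_comm, hs.mul_right_eq_zero] at hz'
      exact hz'
    rw [h3, ← h4]
    rw [← genericPoint_eq_of_isOpenImmersion w.hom]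
    refine (w.hom.isOpenEmbedding.injective.eq_iff
      (a := PrimeSpectrum.comap m'.toRingHom (IsLocalRing.closedPoint F))).trans ?_
    rw [genericPoint_eq_bot_of_affine]
    refine PrimeSpectrum.ext_iff.trans ?_
    change (IsLocalRing.maximalIdeal F).comap m'.toRingHom = ⊥ ↔ _
    rw [IsLocalRing.maximalIdeal_eq_bot]
    exact (RingHom.injective_iff_ker_eq_bot m'.toRingHom).symm

instance : IsDomain (FunField A ⊗[C] FunField A) := (isDomain_and_generic_iff A).1

instance : IsDomain (FieldL A ⊗[C] FunField A) := isDomain_ratFunc_tensor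

/-- The function field of `A × A`, as `Quot(K_A ⊗ K_A)`. -/
abbrev FieldE : Type u := FractionRing (FunField A ⊗[C] FunField A)

/-- The inclusion `K_A → K_{A × A}` given by the first projection. -/
def inclE₁ : FunField A →ₐ[C] FieldE A :=
  (IsScalarTower.toAlgHom C (FunField A ⊗[C] FunField A) (FieldE A)).comp
    Algebra.TensorProduct.includeLeft

/-- The inclusion `K_A → K_{A × A}` given by the second projection. -/
def inclE₂ : FunField A →ₐ[C] FieldE A :=
  (IsScalarTower.toAlgHom C (FunField A ⊗[C] FunField A) (FieldE A)).comp
    Algebra.TensorProduct.includeRight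

omit [IsIntegral (A ⊗ A).left] in
theorem injective_productMap_inclE :
    Function.Injective (Algebra.TensorProduct.productMap (inclE₁ A) (inclE₂ A)) := by
  rw [inclE₁, inclE₂, productMap_comp_include]
  exact IsFractionRing.injective _ _

/-- A morphism with a section maps the generic point to the generic point. -/
theorem map_genericPoint_of_section {X Y : Scheme.{u}} [IrreducibleSpace X] [IrreducibleSpace Y]
    (f : X ⟶ Y) (s : Y ⟶ X) (h : s ≫ f = 𝟙 Y) : f (genericPoint X) = genericPoint Y := by
  refine (((genericPoint_spec Y).eq ?_).symm)
  have hs : Function.Surjective f := fun y => ⟨s y, by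
    change (s ≫ f) y = y
    rw [h]
    rfl⟩
  have := (genericPoint_spec X).image f.continuous
  rwa [Set.image_univ, hs.range_eq, closure_univ] at this

/-- An automorphism of `A × A` induces an endomorphism of `K_{A × A}`, which is determined by the
images of the two generic points. -/
theorem exists_endomorphism (ψ : A ⊗ A ≅ A ⊗ A) (x y : Points A (FieldE A))
    (h : lift (Points.map A (inclE₁ A) (genericPt A)) (Points.map A (inclE₂ A) (genericPt A)) ≫
      ψ.hom = lift x y) :
    ∃ φ : FieldE A →ₐ[C] FieldE A, Points.map A (φ.comp (inclE₁ A)) (genericPt A) = x ∧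
      Points.map A (φ.comp (inclE₂ A)) (genericPt A) = y := by
  -- The pair of the two generic points hits the generic point of `A × A`, and so does its image.
  have h0 := ((isDomain_and_generic_iff A).2 _ _ _).2 (injective_productMap_inclE A)
  have h1 : Points.hom (lift x y) (IsLocalRing.closedPoint (FieldE A)) =
      genericPoint (A ⊗ A).left := by
    have hψ : IsIso ψ.hom.left := ((Over.forget _).mapIso ψ).isIso_hom
    rw [← h, ← genericPoint_eq_of_isOpenImmersion ψ.hom.left, ← h0]
    rfl
  have hx : x.hom (IsLocalRing.closedPoint (FieldE A)) = genericPoint A.left := by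
    rw [← map_genericPoint_of_section (fst A A).left (lift (𝟙 A) (𝟙 A)).left (by
      rw [← Over.comp_left, lift_fst, Over.id_left]), ← h1]
    exact congrArg (fun z : Points A (FieldE A) => z.hom (IsLocalRing.closedPoint (FieldE A)))
      (lift_fst x y).symm
  have hy : y.hom (IsLocalRing.closedPoint (FieldE A)) = genericPoint A.left := by
    rw [← map_genericPoint_of_section (snd A A).left (lift (𝟙 A) (𝟙 A)).left (by
      rw [← Over.comp_left, lift_snd, Over.id_left]), ← h1]
    exact congrArg (fun z : Points A (FieldE A) => z.hom (IsLocalRing.closedPoint (FieldE A)))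
      (lift_snd x y).symm
  obtain ⟨f, rfl⟩ := exists_map_genericPt A x hx
  obtain ⟨g, rfl⟩ := exists_map_genericPt A y hy
  have hfg := ((isDomain_and_generic_iff A).2 _ f g).1 h1
  let φ : FieldE A →ₐ[C] FieldE A :=
    IsFractionRing.liftAlgHom (g := Algebra.TensorProduct.productMap f g) hfg
  have hφ : ∀ z, φ (algebraMap _ _ z) = Algebra.TensorProduct.productMap f g z := fun z =>
    IsFractionRing.lift_algebraMap (g := (Algebra.TensorProduct.productMap f g).toRingHom) hfg z
  refine ⟨φ, ?_, ?_⟩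
  · congr 1
    ext k
    exact (hφ _).trans (by simp)
  · congr 1
    ext k
    exact (hφ _).trans (by simp)

omit [IsIntegral A.left] [IsIntegral (A ⊗ A).left]
variable [GrpObj A]

/-- The automorphism `(x, y) ↦ (x ⊕ y, y)` of `A × A`. -/
def shearRight : A ⊗ A ≅ A ⊗ A where
  hom := lift (fst A A * snd A A) (snd A A)
  inv := lift (fst A A / snd A A) (snd A A)
  hom_inv_id := by
    rw [comp_lift, GrpObj.comp_div, lift_fst, lift_snd, mul_div_cancel_right, lift_fst_snd]
  inv_hom_id := by
    rw [comp_lift, MonObj.comp_mul, lift_fst, lift_snd, div_mul_cancel, lift_fst_snd]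

/-- The automorphism `(x, y) ↦ (x, x⁻¹ ⊕ y)` of `A × A`. -/
def shearLeft : A ⊗ A ≅ A ⊗ A where
  hom := lift (fst A A) ((fst A A)⁻¹ * snd A A)
  inv := lift (fst A A) (fst A A * snd A A)
  hom_inv_id := by
    rw [comp_lift, MonObj.comp_mul, lift_fst, lift_snd, mul_inv_cancel_left, lift_fst_snd]
  inv_hom_id := by
    rw [comp_lift, MonObj.comp_mul, GrpObj.comp_inv, lift_fst, lift_snd, inv_mul_cancel_left,
      lift_fst_snd]

end GenericPairs

/-! ### The automorphism induced by addition -/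

section Translation

variable {C : Type u} [Field C] (A : Over (Spec (.of C))) [IsIntegral A.left]

/-- The inclusion `K_A → L`. -/
def inclK : FunField A →ₐ[C] FieldL A := IsScalarTower.toAlgHom C (FunField A) (FieldL A)

theorem etaL_eq : etaL A = Points.map A (inclK A) (genericPt A) := rfl

theorem ratMap_comp_inclK {F : Type*} [Field F] [Algebra C F] (f : FunField A →ₐ[C] F) :
    (ratMap f).comp (inclK A) = (IsScalarTower.toAlgHom C F (RatFunc F)).comp f :=
  ratMap_comp_toAlgHom f

variable {S : Type u} [CommRing S] [Algebra C S]

theorem algHom_ext_of_map_genericPt {f g : FunField A →ₐ[C] S}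
    (h : Points.map A f (genericPt A) = Points.map A g (genericPt A)) : f = g :=
  Points.map_injective_of_mono A _ h

/-- A homomorphism from `L` is determined by its values at `t` and at the generic point. -/
theorem fieldL_algHom_ext {f g : FieldL A →ₐ[C] S} (hX : f RatFunc.X = g RatFunc.X)
    (h : Points.map A f (etaL A) = Points.map A g (etaL A)) : f = g := by
  rw [etaL_eq, ← Points.map_comp, ← Points.map_comp] at h
  exact ratFunc_algHom_ext hX (algHom_ext_of_map_genericPt A h)

theorem fieldLD_algHom_ext {f g : FieldLD A →ₐ[C] S}
    (hL : f.comp (inclL A) = g.comp (inclL A)) (hD : f.comp (inclD A) = g.comp (inclD A)) :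
    f = g := by
  apply AlgHom.coe_ringHom_injective
  apply IsLocalization.ringHom_ext (nonZeroDivisors (FieldL A ⊗[C] FunField A))
  have : f.comp (IsScalarTower.toAlgHom C (FieldL A ⊗[C] FunField A) (FieldLD A)) =
      g.comp (IsScalarTower.toAlgHom C (FieldL A ⊗[C] FunField A) (FieldLD A)) :=
    Algebra.TensorProduct.ext hL hD
  exact congrArg AlgHom.toRingHom this

variable [IsIntegral (A ⊗ A).left]

theorem exists_fieldLD_algEquiv : ∃ e : FieldLD A ≃ₐ[C] RatFunc (FieldE A),
    e.toAlgHom.comp (inclL A) = ratMap (inclE₁ A) ∧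
    e.toAlgHom.comp (inclD A) =
      (IsScalarTower.toAlgHom C (FieldE A) (RatFunc (FieldE A))).comp (inclE₂ A) := by
  obtain ⟨e, he⟩ := exists_fractionRing_algEquiv (C := C) (K := FunField A) (D := FunField A)
    (E := FieldE A)
  refine ⟨e, AlgHom.ext fun l => (he _).trans ?_, AlgHom.ext fun d => (he _).trans ?_⟩
  · exact (Algebra.TensorProduct.productMap_left_apply _ _ l)
  · exact (Algebra.TensorProduct.productMap_right_apply _ _ d)

/-- An endomorphism of `K_{A × A}` over the second factor extends to one of `LD` over `D(t)`. -/
theorem exists_fieldLD_endomorphism (φ : FieldE A →ₐ[C] FieldE A)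
    (hφ : φ.comp (inclE₂ A) = inclE₂ A) :
    ∃ (ρ : FieldLD A →ₐ[C] FieldLD A) (j : FieldE A →ₐ[C] FieldLD A),
      j.comp (inclE₁ A) = (inclL A).comp (inclK A) ∧ j.comp (inclE₂ A) = inclD A ∧
      ρ (inclL A RatFunc.X) = inclL A RatFunc.X ∧ ρ.comp (inclD A) = inclD A ∧
      (ρ.comp (inclL A)).comp (inclK A) = j.comp (φ.comp (inclE₁ A)) := by
  obtain ⟨e, he₁, he₂⟩ := exists_fieldLD_algEquiv A
  have h₁ : ∀ l, e (inclL A l) = ratMap (inclE₁ A) l := DFunLike.congr_fun he₁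
  have h₂ : ∀ d, e (inclD A d) = algebraMap _ _ (inclE₂ A d) := DFunLike.congr_fun he₂
  have hK : ∀ (f : FunField A →ₐ[C] FieldE A) k,
      ratMap f (inclK A k) = algebraMap _ _ (f k) :=
    fun f => DFunLike.congr_fun (ratMap_comp_inclK A f)
  have hE : ∀ k, ratMap φ (algebraMap _ _ k) = algebraMap _ _ (φ k) :=
    DFunLike.congr_fun (ratMap_comp_toAlgHom φ)
  refine ⟨(e.symm.toAlgHom.comp (ratMap φ)).comp e.toAlgHom,
    e.symm.toAlgHom.comp (IsScalarTower.toAlgHom C (FieldE A) (RatFunc (FieldE A))),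
    AlgHom.ext fun k => ?_, AlgHom.ext fun k => ?_, ?_, AlgHom.ext fun k => ?_,
    AlgHom.ext fun k => ?_⟩
  · change e.symm (algebraMap _ _ (inclE₁ A k)) = _
    rw [AlgEquiv.symm_apply_eq]
    exact ((h₁ _).trans (hK _ k)).symm
  · change e.symm (algebraMap _ _ (inclE₂ A k)) = _
    rw [AlgEquiv.symm_apply_eq, h₂]
  · change e.symm (ratMap φ (e (inclL A RatFunc.X))) = _
    rw [AlgEquiv.symm_apply_eq, h₁, ratMap_X, ratMap_X]
  · change e.symm (ratMap φ (e (inclD A k))) = _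
    rw [AlgEquiv.symm_apply_eq, h₂, hE]
    exact congrArg _ (DFunLike.congr_fun hφ k)
  · change e.symm (ratMap φ (e (inclL A (inclK A k)))) = e.symm (algebraMap _ _ (φ (inclE₁ A k)))
    rw [h₁, hK, hE]

/-- An automorphism of `A × A` over the second factor induces an endomorphism of `LD` over `D(t)`;
here `j` is the inclusion of `K_{A × A}` in `LD`. -/
theorem exists_fieldLD_endomorphism_of_iso (ψ : A ⊗ A ≅ A ⊗ A) (x : Points A (FieldE A))
    (h : lift (Points.map A (inclE₁ A) (genericPt A)) (Points.map A (inclE₂ A) (genericPt A)) ≫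
      ψ.hom = lift x (Points.map A (inclE₂ A) (genericPt A))) :
    ∃ (ρ : FieldLD A →ₐ[C] FieldLD A) (j : FieldE A →ₐ[C] FieldLD A),
      j.comp (inclE₁ A) = (inclL A).comp (inclK A) ∧ j.comp (inclE₂ A) = inclD A ∧
      ρ (inclL A RatFunc.X) = inclL A RatFunc.X ∧ ρ.comp (inclD A) = inclD A ∧
      Points.map A (ρ.comp (inclL A)) (etaL A) = Points.map A j x := by
  obtain ⟨φ, h1, h2⟩ := exists_endomorphism A ψ _ _ h
  obtain ⟨ρ, j, hj₁, hj₂, hX, hD, hL⟩ := exists_fieldLD_endomorphism A φ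
    (algHom_ext_of_map_genericPt A h2)
  refine ⟨ρ, j, hj₁, hj₂, hX, hD, ?_⟩
  rw [etaL_eq, ← Points.map_comp, hL, Points.map_comp, h1]

variable [GrpObj A]

omit [IsIntegral (A ⊗ A).left] in
theorem IsInducedByAddition.unique {ρ ρ' : FieldLD A →ₐ[C] FieldLD A}
    (h : IsInducedByAddition A ρ) (h' : IsInducedByAddition A ρ') : ρ' = ρ := by
  refine fieldLD_algHom_ext A (fieldL_algHom_ext A ?_ ?_) (AlgHom.ext fun d => ?_)
  · exact h'.1.trans h.1.symm
  · exact h'.2.2.trans h.2.2.symm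
  · exact (h'.2.1 d).trans (h.2.1 d).symm

/-- The homomorphism `ρ` and its inverse come from the automorphism `(x, y) ↦ (x ⊕ y, y)` of
`A × A` and from its inverse. -/
theorem exists_isInducedByAddition : ∃ ρ : FieldLD A ≃ₐ[C] FieldLD A,
    IsInducedByAddition A ρ.toAlgHom := by
  set ξ₁ := Points.map A (inclE₁ A) (genericPt A)
  set ξ₂ := Points.map A (inclE₂ A) (genericPt A)
  obtain ⟨ρ, j, hj₁, hj₂, hX, hD, hL⟩ := exists_fieldLD_endomorphism_of_iso A (shearRight A)
    (ξ₁ * ξ₂) (by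
      change lift ξ₁ ξ₂ ≫ lift (fst A A * snd A A) (snd A A) = lift (ξ₁ * ξ₂) ξ₂
      rw [comp_lift, MonObj.comp_mul, lift_fst, lift_snd])
  obtain ⟨σ, k, hk₁, hk₂, hX', hD', hL'⟩ := exists_fieldLD_endomorphism_of_iso A (shearRight A).symm
    (ξ₁ / ξ₂) (by
      change lift ξ₁ ξ₂ ≫ lift (fst A A / snd A A) (snd A A) = lift (ξ₁ / ξ₂) ξ₂
      rw [comp_lift, GrpObj.comp_div, lift_fst, lift_snd])
  rw [Points.map_mul, ← Points.map_comp, ← Points.map_comp, hj₁, hj₂] at hL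
  rw [Points.map_div, ← Points.map_comp, ← Points.map_comp, hk₁, hk₂] at hL'
  have h₁ : ρ.comp σ = AlgHom.id C _ := by
    refine fieldLD_algHom_ext A (fieldL_algHom_ext A ?_ ?_) ?_
    · exact (congrArg ρ hX').trans hX
    · rw [AlgHom.comp_assoc, Points.map_comp, hL', Points.map_div, ← Points.map_comp,
        ← Points.map_comp, hD, ← AlgHom.comp_assoc, Points.map_comp _ (inclK A), ← etaL_eq, hL,
        mul_div_cancel_right, AlgHom.id_comp, etaL_eq, Points.map_comp]
    · rw [AlgHom.comp_assoc, hD', hD, AlgHom.id_comp]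
  have h₂ : σ.comp ρ = AlgHom.id C _ := by
    refine fieldLD_algHom_ext A (fieldL_algHom_ext A ?_ ?_) ?_
    · exact (congrArg σ hX).trans hX'
    · rw [AlgHom.comp_assoc, Points.map_comp, hL, Points.map_mul, ← Points.map_comp,
        ← Points.map_comp, hD', ← AlgHom.comp_assoc, Points.map_comp _ (inclK A), ← etaL_eq, hL',
        div_mul_cancel, AlgHom.id_comp, etaL_eq, Points.map_comp]
    · rw [AlgHom.comp_assoc, hD, hD', AlgHom.id_comp]
  refine ⟨AlgEquiv.ofAlgHom ρ σ h₁ h₂, hX, DFunLike.congr_fun hD,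
    hL.trans (congrArg (· * _) (Points.map_comp A (inclK A) (inclL A) _))⟩

/-- The elements of `L` fixed by `ρ` are those of `C(t)`. Together with `(x, y) ↦ (x, x⁻¹ ⊕ y)`,
an equality `f(x ⊕ y) = f(x)` of rational functions turns into `f(y) = f(x)`. -/
theorem IsInducedByAddition.mem_range_ratInclusion {ρ : FieldLD A →ₐ[C] FieldLD A}
    (h : IsInducedByAddition A ρ) {l : FieldL A} (hl : ρ (inclL A l) = inclL A l) :
    l ∈ Set.range (ratInclusion C (FunField A)) := by
  set ξ₁ := Points.map A (inclE₁ A) (genericPt A) with hξ₁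
  set ξ₂ := Points.map A (inclE₂ A) (genericPt A) with hξ₂
  obtain ⟨τ, h₁, h₂⟩ := exists_endomorphism A (shearLeft A) ξ₁ (ξ₁⁻¹ * ξ₂) (by
    change lift ξ₁ ξ₂ ≫ lift (fst A A) ((fst A A)⁻¹ * snd A A) = lift ξ₁ (ξ₁⁻¹ * ξ₂)
    rw [comp_lift, MonObj.comp_mul, GrpObj.comp_inv, lift_fst, lift_snd])
  obtain ⟨e, he₁, he₂⟩ := exists_fieldLD_algEquiv A
  set ε := IsScalarTower.toAlgHom C (FieldE A) (RatFunc (FieldE A))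
  have hτ₁ : τ.comp (inclE₁ A) = inclE₁ A := algHom_ext_of_map_genericPt A h₁
  -- `σ` is `(x, y) ↦ (x, x⁻¹ ⊕ y)`: it keeps `l` in the first variable and moves `ρ(l)` to the
  -- second.
  set σ := (ratMap τ).comp e.toAlgHom with hσ
  have hσL : σ.comp (inclL A) = ratMap (inclE₁ A) := by
    rw [hσ, AlgHom.comp_assoc, he₁]
    refine ratFunc_algHom_ext (by simp only [AlgHom.comp_apply, ratMap_X]) ?_
    change ((ratMap τ).comp (ratMap (inclE₁ A))).comp (inclK A) = (ratMap (inclE₁ A)).comp (inclK A)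
    rw [AlgHom.comp_assoc, ratMap_comp_inclK, ← AlgHom.comp_assoc, ratMap_comp_toAlgHom,
      AlgHom.comp_assoc, hτ₁]
  have hσD : σ.comp (inclD A) = ε.comp (τ.comp (inclE₂ A)) := by
    rw [hσ, AlgHom.comp_assoc, he₂, ← AlgHom.comp_assoc, ratMap_comp_toAlgHom, AlgHom.comp_assoc]
  have hσρ : σ.comp (ρ.comp (inclL A)) = ratMap (inclE₂ A) := by
    refine fieldL_algHom_ext A ?_ ?_
    · refine ((congrArg σ h.1).trans ?_).trans (ratMap_X _).symm
      exact (DFunLike.congr_fun hσL _).trans (ratMap_X _)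
    · rw [Points.map_comp, h.2.2, Points.map_mul, ← Points.map_comp, ← Points.map_comp, hσL, hσD,
        Points.map_comp _ _ ε, h₂, etaL_eq, ← Points.map_comp, ← Points.map_comp,
        ratMap_comp_inclK, ratMap_comp_inclK, Points.map_comp, Points.map_comp, ← hξ₁, ← hξ₂,
        ← Points.map_mul, mul_inv_cancel_left]
  refine IDGroup.mem_range_ratInclusion (injective_productMap_inclE A) ?_
  rw [← hσL, ← hσρ]
  exact (congrArg σ hl).symm

end Translation

/-! ### The ring of shifted power series -/

section Derivations

variable {C : Type*} [Field C]

theorem ratDerivation_X :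
    (ratDerivation C).toAlgHom RatFunc.X = PowerSeries.C RatFunc.X + PowerSeries.X := by
  have h : (ratDerivation C).toAlgHom (algebraMap (Polynomial C) (RatFunc C) Polynomial.X) =
      PowerSeries.mapAlgHom (IsScalarTower.toAlgHom C (Polynomial C) (RatFunc C))
        ((polyDerivation C).toAlgHom Polynomial.X) :=
    IsLocalization.lift_eq _ _
  rw [RatFunc.algebraMap_X] at h
  rw [h]
  simp [polyDerivation, PowerSeries.mapAlgHom_apply]

/-- `P(t, T) ↦ P(t + U, T)`, which identifies `C(t)⟦T⟧` with the ring `R`. -/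
def toShiftRing : (RatFunc C)⟦X⟧ →ₐ[C] shiftRing C :=
  AlgHom.codRestrict (PowerSeries.mapAlgHom (ratDerivation C).toAlgHom) (shiftRing C) (by
    intro P
    have : (PowerSeries.mapAlgHom (evalZero C (RatFunc C))).comp
        (PowerSeries.mapAlgHom (ratDerivation C).toAlgHom) = AlgHom.id C _ := by
      rw [mapAlgHom_comp, HigherDerivation.evalZero_comp, mapAlgHom_id]
    change PowerSeries.mapAlgHom (ratDerivation C).toAlgHom
      (((PowerSeries.mapAlgHom (evalZero C (RatFunc C))).comp
        (PowerSeries.mapAlgHom (ratDerivation C).toAlgHom)) P) =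
      PowerSeries.mapAlgHom (ratDerivation C).toAlgHom P
    rw [this]
    rfl)

theorem val_comp_toShiftRing : (shiftRing C).val.comp toShiftRing =
    PowerSeries.mapAlgHom (ratDerivation C).toAlgHom := rfl

theorem toShiftRing_comp_evalZero :
    (PowerSeries.mapAlgHom (ratDerivation C).toAlgHom).comp
      ((PowerSeries.mapAlgHom (evalZero C (RatFunc C))).comp (shiftRing C).val) =
      (shiftRing C).val :=
  AlgHom.ext fun P => P.2

theorem mapAlgHom_comp_evalZero {R S : Type*} [CommRing R] [Algebra C R] [CommRing S]
    [Algebra C S] (f : R →ₐ[C] S) :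
    (evalZero C S).comp (PowerSeries.mapAlgHom f) = f.comp (evalZero C R) :=
  AlgHom.ext fun P => constantCoeff_map_eq (f : R →+* S) P

end Derivations

/-! ### The difference of the generic point and its image -/

section Main

variable {C : Type u} [Field C] (A : Over (Spec (.of C))) [IsIntegral A.left]
  (θ : HigherDerivation C (FieldL A))

theorem derivationLD_comp_inclL : (derivationLD A θ).toAlgHom.comp (inclL A) =
    (PowerSeries.mapAlgHom (inclL A)).comp θ.toAlgHom := by
  ext l : 1
  have h : (derivationLD A θ).toAlgHom (inclL A l) =
      PowerSeries.mapAlgHom (IsScalarTower.toAlgHom C (FieldL A ⊗[C] FunField A) (FieldLD A))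
        ((θ.tensor (HigherDerivation.trivial C (FunField A))).toAlgHom (l ⊗ₜ 1)) :=
    IsLocalization.lift_eq _ _
  refine h.trans ?_
  rw [inclL, ← mapAlgHom_comp]
  refine congrArg _ ?_
  simp [HigherDerivation.tensor]

theorem derivationLD_comp_inclD : (derivationLD A θ).toAlgHom.comp (inclD A) =
    (constSeries C (FieldLD A)).comp (inclD A) := by
  ext d : 1
  have h : (derivationLD A θ).toAlgHom (inclD A d) =
      PowerSeries.mapAlgHom (IsScalarTower.toAlgHom C (FieldL A ⊗[C] FunField A) (FieldLD A))
        ((θ.tensor (HigherDerivation.trivial C (FunField A))).toAlgHom (1 ⊗ₜ d)) :=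
    IsLocalization.lift_eq _ _
  refine h.trans ?_
  rw [inclD, ← AlgHom.comp_assoc, ← mapAlgHom_comp_constSeries]
  refine congrArg _ ?_
  simp only [HigherDerivation.tensor, HigherDerivation.trivial,
    Algebra.TensorProduct.lift_tmul, map_one]
  refine (_root_.one_mul _).trans ?_
  exact DFunLike.congr_fun (mapAlgHom_comp_constSeries (C := C) _) d

theorem isIterative_derivationLD (hθ : θ.IsIterative) : (derivationLD A θ).IsIterative := by
  rw [HigherDerivation.isIterative_iff_map_comp] at hθ ⊢
  refine fieldLD_algHom_ext A ?_ ?_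
  · rw [HigherDerivation.inTU, AlgHom.comp_assoc, AlgHom.comp_assoc, derivationLD_comp_inclL,
      ← AlgHom.comp_assoc, mapAlgHom_comp, derivationLD_comp_inclL, ← mapAlgHom_comp,
      AlgHom.comp_assoc, hθ, HigherDerivation.inTU, ← AlgHom.comp_assoc, ← AlgHom.comp_assoc,
      mapAlgHom_map_comp_addSubst]
  · rw [HigherDerivation.inTU, AlgHom.comp_assoc, AlgHom.comp_assoc, derivationLD_comp_inclD,
      ← AlgHom.comp_assoc, mapAlgHom_comp_constSeries, AlgHom.comp_assoc, derivationLD_comp_inclD,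
      ← AlgHom.comp_assoc, ← AlgHom.comp_assoc, addSubst_comp_constSeries]

variable {A θ}

theorem ExtendsRat.apply_X (hθ : ExtendsRat A θ) :
    θ.toAlgHom RatFunc.X = PowerSeries.C RatFunc.X + PowerSeries.X := by
  have h := DFunLike.congr_fun hθ RatFunc.X
  rw [AlgHom.comp_apply, AlgHom.comp_apply, ratDerivation_X, ratInclusion_eq_ratMap, ratMap_X] at h
  rw [h, PowerSeries.mapAlgHom_apply, map_add, PowerSeries.map_C, PowerSeries.map_X]
  congr 2
  exact ratMap_X _

variable [GrpObj A]

variable (A θ) in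
/-- The difference `η_L ⊖ θ_*(η_L)` in `A(L⟦T⟧)`. -/
def difference : Points A (FieldL A)⟦X⟧ :=
  Points.map A (constSeries C (FieldL A)) (etaL A) / Points.map A θ.toAlgHom (etaL A)

/-- `ρ` is an HD-homomorphism if and only if `η_L ⊖ θ_*(η_L)` is invariant under `ρ`: both sides
say that `ρ_*(θ_*(η_L)) = θ_*(η_L) ⊕ η_D`. -/
theorem isHDHom_iff_map_difference (hθ : ExtendsRat A θ) {ρ : FieldLD A →ₐ[C] FieldLD A}
    (hρ : IsInducedByAddition A ρ) : IsHDHom (derivationLD A θ) (derivationLD A θ) ρ ↔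
      Points.map A (PowerSeries.mapAlgHom (ρ.comp (inclL A))) (difference A θ) =
        Points.map A (PowerSeries.mapAlgHom (inclL A)) (difference A θ) := by
  set c := Points.map A ((constSeries C (FieldLD A)).comp (inclD A)) (genericPt A) with hc
  have hL := derivationLD_comp_inclL A θ
  have hD := derivationLD_comp_inclD A θ
  have hρD : ρ.comp (inclD A) = inclD A := AlgHom.ext hρ.2.1
  have e₁ : IsHDHom (derivationLD A θ) (derivationLD A θ) ρ ↔
      Points.map A ((PowerSeries.mapAlgHom (inclL A)).comp θ.toAlgHom) (etaL A) * c =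
      Points.map A ((PowerSeries.mapAlgHom (ρ.comp (inclL A))).comp θ.toAlgHom) (etaL A) := by
    have h₁ : Points.map A (((derivationLD A θ).toAlgHom.comp ρ).comp (inclL A)) (etaL A) =
        Points.map A ((PowerSeries.mapAlgHom (inclL A)).comp θ.toAlgHom) (etaL A) * c := by
      rw [AlgHom.comp_assoc, Points.map_comp, hρ.2.2, Points.map_mul, ← Points.map_comp,
        ← Points.map_comp, hL, hD]
    have h₂ : ((PowerSeries.mapAlgHom ρ).comp (derivationLD A θ).toAlgHom).comp (inclL A) =
        (PowerSeries.mapAlgHom (ρ.comp (inclL A))).comp θ.toAlgHom := by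
      rw [AlgHom.comp_assoc, hL, ← AlgHom.comp_assoc, mapAlgHom_comp]
    rw [← h₁, ← h₂]
    refine ⟨fun h => by rw [h], fun h => ?_⟩
    refine fieldLD_algHom_ext A (fieldL_algHom_ext A ?_ h) ?_
    · rw [h₂]
      change (derivationLD A θ).toAlgHom (ρ (inclL A RatFunc.X)) = _
      rw [hρ.1]
      refine (DFunLike.congr_fun hL _).trans ?_
      rw [AlgHom.comp_apply, AlgHom.comp_apply, hθ.apply_X]
      simp only [PowerSeries.mapAlgHom_apply, map_add, PowerSeries.map_C, PowerSeries.map_X]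
      congr 2
      exact hρ.1.symm
    · rw [AlgHom.comp_assoc, hρD, AlgHom.comp_assoc, hD, ← AlgHom.comp_assoc,
        mapAlgHom_comp_constSeries, AlgHom.comp_assoc, hρD]
  have e₂ : Points.map A (constSeries C (FieldLD A)) (Points.map A (ρ.comp (inclL A)) (etaL A)) =
      Points.map A (constSeries C (FieldLD A)) (Points.map A (inclL A) (etaL A)) * c := by
    rw [hρ.2.2, Points.map_mul, hc, Points.map_comp]
  -- With `w = θ_*(η_L)`, `z = ρ_*(θ_*(η_L))` and `b = η_D`.
  have group : ∀ a w z b : Points A (FieldLD A)⟦X⟧, w * b = z ↔ a * b / z = a / w := by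
    intro a w z b
    rw [mul_div_assoc, div_eq_mul_inv a w, mul_right_inj, div_eq_iff_eq_mul, eq_inv_mul_iff_mul_eq]
  rw [e₁, difference, Points.map_div, Points.map_div, ← Points.map_comp, ← Points.map_comp,
    mapAlgHom_comp_constSeries, Points.map_comp _ _ (constSeries C (FieldLD A)), e₂,
    ← Points.map_comp, ← Points.map_comp, mapAlgHom_comp_constSeries,
    Points.map_comp _ _ (constSeries C (FieldLD A)), ← Points.map_comp _ θ.toAlgHom]
  exact group _ _ _ _

variable [IsIntegral (A ⊗ A).left]

theorem map_difference_eq_iff {ρ : FieldLD A →ₐ[C] FieldLD A} (hρ : IsInducedByAddition A ρ) :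
    Points.map A (PowerSeries.mapAlgHom (ρ.comp (inclL A))) (difference A θ) =
        Points.map A (PowerSeries.mapAlgHom (inclL A)) (difference A θ) ↔
      ∃ x : Points A (RatFunc C)⟦X⟧,
        Points.map A (PowerSeries.mapAlgHom (ratInclusion C (FunField A))) x =
          difference A θ := by
  constructor
  · refine Points.mem_range_map_of_isLocalRing A ?_ fun P hP => ?_
    · intro P Q h
      ext i
      refine (ratInclusion C (FunField A)).toRingHom.injective ?_
      have := congrArg (PowerSeries.coeff i) h
      rwa [PowerSeries.mapAlgHom_apply, PowerSeries.mapAlgHom_apply, PowerSeries.coeff_map,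
        PowerSeries.coeff_map] at this
    · have hi : ∀ i, PowerSeries.coeff i P ∈ Set.range (ratInclusion C (FunField A)) := by
        intro i
        refine hρ.mem_range_ratInclusion A ?_
        have := congrArg (PowerSeries.coeff i) hP
        rwa [PowerSeries.mapAlgHom_apply, PowerSeries.mapAlgHom_apply, PowerSeries.coeff_map,
          PowerSeries.coeff_map] at this
      choose Q hQ using hi
      refine ⟨PowerSeries.mk Q, ?_⟩
      ext i
      rw [PowerSeries.mapAlgHom_apply, PowerSeries.coeff_map, PowerSeries.coeff_mk]
      exact hQ i
  · rintro ⟨x, hx⟩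
    have : (ρ.comp (inclL A)).comp (ratInclusion C (FunField A)) =
        (inclL A).comp (ratInclusion C (FunField A)) := by
      refine ratFunc_algHom_ext ?_ (AlgHom.ext fun c => ?_)
      · change ρ (inclL A (ratMap _ RatFunc.X)) = inclL A (ratMap _ RatFunc.X)
        rw [ratMap_X]
        exact hρ.1
      · exact (AlgHom.commutes _ c).trans (AlgHom.commutes _ c).symm
    rw [← hx, ← Points.map_comp, ← Points.map_comp, mapAlgHom_comp, mapAlgHom_comp, this]

omit [IsIntegral (A ⊗ A).left] in
theorem map_difference_of_isIterative (hθ : θ.IsIterative) :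
    Points.map A (PowerSeries.mapAlgHom θ.toAlgHom) (difference A θ) =
      Points.map A θ.inU (etaL A) / Points.map A θ.inTU (etaL A) := by
  rw [difference, Points.map_div, ← Points.map_comp, ← Points.map_comp,
    (θ.isIterative_iff_map_comp).1 hθ, mapAlgHom_comp_constSeries]
  rfl

omit [IsIntegral (A ⊗ A).left] in
/-- Over `C(t)⟦T⟧ ≅ R`, the point `η_L ⊖ θ_*(η_L)` corresponds to
`θ_{U,*}(η_L) ⊖ θ_{T+U,*}(η_L)`. -/
theorem differenceInR_iff (hθ : ExtendsRat A θ) : DifferenceInR A θ ↔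
    θ.IsIterative ∧ ∃ x : Points A (RatFunc C)⟦X⟧,
      Points.map A (PowerSeries.mapAlgHom (ratInclusion C (FunField A))) x = difference A θ := by
  have hcomm : (PowerSeries.mapAlgHom (PowerSeries.mapAlgHom (ratInclusion C (FunField A)))).comp
      (PowerSeries.mapAlgHom (ratDerivation C).toAlgHom) =
      (PowerSeries.mapAlgHom θ.toAlgHom).comp
        (PowerSeries.mapAlgHom (ratInclusion C (FunField A))) := by
    rw [mapAlgHom_comp, mapAlgHom_comp, hθ]
  constructor
  · rintro ⟨x, hx⟩
    set x₀ := Points.map A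
      ((PowerSeries.mapAlgHom (evalZero C (RatFunc C))).comp (shiftRing C).val) x with hx₀
    have h₀ : Points.map A (PowerSeries.mapAlgHom (ratInclusion C (FunField A))) x₀ =
        difference A θ := by
      have := congrArg (Points.map A (PowerSeries.mapAlgHom (evalZero C (FieldL A)))) hx
      rw [Points.map_div, ← Points.map_comp, ← Points.map_comp, ← Points.map_comp,
        θ.map_evalZero_comp_inU, θ.map_evalZero_comp_inTU, ← AlgHom.comp_assoc, mapAlgHom_comp,
        mapAlgHom_comp_evalZero, ← mapAlgHom_comp, AlgHom.comp_assoc, Points.map_comp] at this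
      exact this
    refine ⟨?_, x₀, h₀⟩
    -- Applying `θ_U` to `δ` and comparing with `hx` gives `θ_U ∘ θ_T = θ_{T+U}` at `η_L`.
    have h₁ : Points.map A (PowerSeries.mapAlgHom θ.toAlgHom) (difference A θ) =
        Points.map A θ.inU (etaL A) / Points.map A θ.inTU (etaL A) := by
      rw [← h₀, ← Points.map_comp, ← hcomm, hx₀, ← Points.map_comp, AlgHom.comp_assoc,
        toShiftRing_comp_evalZero, hx]
    rw [difference, Points.map_div, ← Points.map_comp, ← Points.map_comp,
      mapAlgHom_comp_constSeries] at h₁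
    change Points.map A θ.inU (etaL A) / _ = _ at h₁
    rw [div_right_inj] at h₁
    rw [HigherDerivation.isIterative_iff_map_comp]
    refine fieldL_algHom_ext A ?_ h₁
    rw [AlgHom.comp_apply, HigherDerivation.inTU, AlgHom.comp_apply, hθ.apply_X, map_add, map_add,
      PowerSeries.mapAlgHom_apply, PowerSeries.mapAlgHom_apply, PowerSeries.map_C,
      PowerSeries.map_X]
    change PowerSeries.C (θ.toAlgHom RatFunc.X) + _ = addSubstFun _ + addSubstFun _
    rw [hθ.apply_X, addSubstFun_C, addSubstFun_X, map_add]
    abel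
  · rintro ⟨hit, x, hx⟩
    refine ⟨Points.map A toShiftRing x, ?_⟩
    rw [← Points.map_comp, AlgHom.comp_assoc, val_comp_toShiftRing, hcomm, Points.map_comp, hx,
      map_difference_of_isIterative hit]

end Main

end IDGroup

end

theorem mainTheorem1 {C : Type*} [Field C] (p : ℕ) [Fact p.Prime] [CharP C p]
    (A : Over (Spec (.of C))) [GrpObj A] [IsIntegral A.left] [IsIntegral (A ⊗ A).left]
    (θ : IDGroup.HigherDerivation C (IDGroup.FieldL A)) (hθ : IDGroup.ExtendsRat A θ) :
    ∃ ρ : IDGroup.FieldLD A ≃ₐ[C] IDGroup.FieldLD A,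
      IDGroup.IsInducedByAddition A ρ.toAlgHom ∧
      (∀ ρ' : IDGroup.FieldLD A →ₐ[C] IDGroup.FieldLD A,
        IDGroup.IsInducedByAddition A ρ' → ρ' = ρ.toAlgHom) ∧
      ((θ.IsIterative ∧
          IDGroup.IsIDHom (IDGroup.derivationLD A θ) (IDGroup.derivationLD A θ) ρ.toAlgHom) ↔
        IDGroup.DifferenceInR A θ) := by
  obtain ⟨ρ, hρ⟩ := IDGroup.exists_isInducedByAddition A
  refine ⟨ρ, hρ, fun ρ' hρ' => hρ.unique A hρ', ?_⟩
  rw [IDGroup.differenceInR_iff hθ, ← IDGroup.map_difference_eq_iff hρ,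
    ← IDGroup.isHDHom_iff_map_difference hθ hρ]
  exact ⟨fun h => ⟨h.1, h.2.2.2⟩, fun h =>
    ⟨h.1, IDGroup.isIterative_derivationLD A θ h.1, IDGroup.isIterative_derivationLD A θ h.1, h.2⟩⟩
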